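/- Let $\Gamma$ be a standard graph: a connected metric graph with finite non-empty sets of vertices and edges (loops and multiple edges allowed, a loop counting twice in the degree), with edge lengths $l_e\in(0,\infty)$ and no vertex of degree two, equipped with the Laplacian $f|_e\mapsto -f|_e''$ on the functions in $\bigoplus_e H^2([0,l_e])$ that satisfy the Neumann (Kirchhoff) conditions at every vertex: $f$ is continuous at the vertex and its outgoing derivatives there sum to zero. Let $L_{\min}$ be the minimal edge length. The boundary $\partial\Gamma$ is the set of vertices of degree one; the other vertices are called interior. An eigenfunction $f$ of $\Gamma$ is generic if its eigenvalue is simple, $f$ vanishes at no vertex, and no outgoing derivative of $f$ vanishes at an interior vertex. A Neumann point of $f$ is a point of $\Gamma$ that is not a vertex and at which $f'=0$. A Neumann domain of $f$ is a connected component $\Omega$ of $\Gamma$ without the Neumann points of $f$. It is considered as a standard graph with Neumann conditions at all of its vertices, where each end of $\Omega$ at a Neumann point becomes a vertex of degree one of $\Omega$ (the two sides of a Neumann point are not attached to each other). Denote by $|\partial\Omega|$ the number of vertices of degree one of $\Omega$ and by $|\Omega|$ the sum of its edge lengths. If $f$ has eigenvalue $k^2$, the spectral position $N(\Omega)$ is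 the number of eigenvalues $\lambda$ of $\Omega$ with $0\le\lambda<k^2$, counted with multiplicity, and the wavelength capacity of $\Omega$ is $\rho(\Omega)=|\Omega|\,k/\pi$. Proposition. Let $f$ be a generic eigenfunction of $\Gamma$ with eigenvalue $k^2$, where $k>\pi/L_{\min}$, and let $\Omega$ be a Neumann domain of $f$. Then $$1\le N(\Omega)\le|\partial\Omega|-1,$$ $$1\le\tfrac12\big(N(\Omega)+1\big)\le\rho(\Omega)\le\tfrac12\big(N(\Omega)+|\partial\Omega|-1\big)\le|\partial\Omega|-1.$$ -/

import Mathlib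

open scoped ENNReal

noncomputable section

/-- A metric graph with vertex set `V` and edge set `E`. The edge `e` is identified with the interval
`[0, length e]`; its end `0` is attached to the vertex `endpt e false`, its end `length e` to
`endpt e true`. Loops and multiple edges are allowed. -/
structure MetricGraph (V E : Type*) where
  endpt : E → Bool → V
  length : E → ℝ
  length_pos : ∀ e, 0 < length e

namespace MetricGraph

/-- The points of a metric graph: its vertices and the interior points of its edges. -/
inductive Point {V E : Type*} (Γ : MetricGraph V E) : Type _
  | vertex (v : V) : Point Γ
  | inner (e : E) (x : ℝ) (hx : x ∈ Set.Ioo 0 (Γ.length e)) : Point Γ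

open Classical in
/-- The point at coordinate `x ∈ [0, length e]` of the edge `e` (constant outside that interval). -/
def pt {V E : Type*} (Γ : MetricGraph V E) (e : E) (x : ℝ) : Γ.Point :=
  if hx : x ∈ Set.Ioo 0 (Γ.length e) then Point.inner e x hx
  else if x ≤ 0 then Point.vertex (Γ.endpt e false)
  else Point.vertex (Γ.endpt e true)

/-- The metric graph as a topological space: the closed edges glued at the vertices. -/
instance {V E : Type*} (Γ : MetricGraph V E) : TopologicalSpace Γ.Point :=
  TopologicalSpace.coinduced
    (fun p : (Σ e : E, Set.Icc (0 : ℝ) (Γ.length e)) => Γ.pt p.1 p.2) inferInstance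

/-- The degree of a vertex: the number of edge ends attached to it, a loop counting twice. -/
def degree {V E : Type*} (Γ : MetricGraph V E) (v : V) : ℕ :=
  Nat.card {h : E × Bool // Γ.endpt h.1 h.2 = v}

/-- The boundary of a graph: its vertices of degree one. -/
def boundary {V E : Type*} (Γ : MetricGraph V E) : Set V :=
  {v | Γ.degree v = 1}

/-- A standard graph: connected, finite, with at least one edge, without vertices of degree two. -/
structure IsStandard {V E : Type*} (Γ : MetricGraph V E) : Prop where
  finite_vertices : Finite V
  finite_edges : Finite E
  nonempty_vertices : Nonempty V
  nonempty_edges : Nonempty E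
  connected : ConnectedSpace Γ.Point
  degree_ne_two : ∀ v, Γ.degree v ≠ 2

/-- The minimal edge length. -/
def minLength {V E : Type*} (Γ : MetricGraph V E) : ℝ := ⨅ e, Γ.length e

/-- The sum of all edge lengths. -/
def totalLength {V E : Type*} (Γ : MetricGraph V E) : ℝ := ∑' e, Γ.length e

/-- The restriction `f|_e`, as a function of the coordinate on `[0, length e]`. -/
def onEdge {V E : Type*} (Γ : MetricGraph V E) (f : Γ.Point → ℂ) (e : E) (x : ℝ) : ℂ :=
  f (Γ.pt e x)

/-- The derivative of `f|_e` on the interval `[0, length e]`, one-sided at its ends. -/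
def edgeDeriv {V E : Type*} (Γ : MetricGraph V E) (f : Γ.Point → ℂ) (e : E) (x : ℝ) : ℂ :=
  derivWithin (Γ.onEdge f e) (Set.Icc 0 (Γ.length e)) x

/-- The derivative of `f` at an end of the edge `e`, in the direction from the end into the edge. -/
def outDeriv {V E : Type*} (Γ : MetricGraph V E) (f : Γ.Point → ℂ) (e : E) : Bool → ℂ
  | false => Γ.edgeDeriv f e 0
  | true => -Γ.edgeDeriv f e (Γ.length e)

/-- `u` belongs to the Sobolev space `H²` of the interval `[0, L]` (through its continuous
representative), with first derivative `p` and second weak derivative `g`: both `u` and `p` are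
the integrals of their derivatives and `g` is square integrable. -/
structure IsH2 (L : ℝ) (u p g : ℝ → ℂ) : Prop where
  memLp : MeasureTheory.MemLp g 2 (MeasureTheory.volume.restrict (Set.Icc 0 L))
  eq_integral : ∀ x ∈ Set.Icc 0 L, u x = u 0 + ∫ t in (0 : ℝ)..x, p t
  deriv_eq_integral : ∀ x ∈ Set.Icc 0 L, p x = p 0 + ∫ t in (0 : ℝ)..x, g t

theorem IsH2.continuousOn {L : ℝ} {u p g : ℝ → ℂ} (hL : 0 < L) (h : IsH2 L u p g) :
    ContinuousOn p (Set.Icc 0 L) := by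
  have hg : MeasureTheory.IntegrableOn g (Set.Icc 0 L) :=
    h.memLp.integrable (by norm_num)
  have h1 := intervalIntegral.continuousOn_primitive_interval
    (a := 0) (b := L) (f := g) (μ := MeasureTheory.volume) (by rwa [Set.uIcc_of_le hL.le])
  rw [Set.uIcc_of_le hL.le] at h1
  exact (continuousOn_const.add h1).congr h.deriv_eq_integral

theorem IsH2.differentiableWithinAt {L : ℝ} {u p g : ℝ → ℂ} (hL : 0 < L) (h : IsH2 L u p g)
    {x : ℝ} (hx : x ∈ Set.Icc 0 L) : HasDerivWithinAt u (p x) (Set.Icc 0 L) x := by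
  have hc := h.continuousOn hL
  have : Fact (x ∈ Set.Icc 0 L) := ⟨hx⟩
  have hI : IntervalIntegrable p MeasureTheory.volume 0 x :=
    (hc.mono (Set.Icc_subset_Icc_right hx.2)).intervalIntegrable_of_Icc hx.1
  have hd := intervalIntegral.integral_hasDerivWithinAt_right (s := Set.Icc 0 L)
    (t := Set.Icc 0 L) hI
    (hc.stronglyMeasurableAtFilter_nhdsWithin measurableSet_Icc x) (hc x hx)
  exact ((hd.const_add (u 0)).congr h.eq_integral (h.eq_integral x hx))

theorem IsH2.add {L : ℝ} {u p g u' p' g' : ℝ → ℂ} (hL : 0 < L) (h : IsH2 L u p g)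
    (h' : IsH2 L u' p' g') : IsH2 L (u + u') (p + p') (g + g') := by
  have hint : ∀ {q : ℝ → ℂ}, MeasureTheory.IntegrableOn q (Set.Icc 0 L) → ∀ x ∈ Set.Icc 0 L,
      IntervalIntegrable q MeasureTheory.volume 0 x := by
    intro q hq x hx
    exact (intervalIntegrable_iff_integrableOn_Icc_of_le hx.1).2
      (hq.mono_set (Set.Icc_subset_Icc_right hx.2))
  refine ⟨h.memLp.add h'.memLp, fun x hx => ?_, fun x hx => ?_⟩
  · have e := intervalIntegral.integral_add
      (hint (h.continuousOn hL).integrableOn_Icc x hx)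
      (hint (h'.continuousOn hL).integrableOn_Icc x hx)
    simp only [Pi.add_apply]
    rw [e, h.eq_integral x hx, h'.eq_integral x hx]
    ring
  · have e := intervalIntegral.integral_add
      (hint (h.memLp.integrable (by norm_num)) x hx)
      (hint (h'.memLp.integrable (by norm_num)) x hx)
    simp only [Pi.add_apply]
    rw [e, h.deriv_eq_integral x hx, h'.deriv_eq_integral x hx]
    ring

theorem IsH2.smul {L : ℝ} {u p g : ℝ → ℂ} (c : ℂ) (h : IsH2 L u p g) :
    IsH2 L (c • u) (c • p) (c • g) := by
  refine ⟨h.memLp.const_smul c, fun x hx => ?_, fun x hx => ?_⟩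
  · simp only [Pi.smul_apply, smul_eq_mul, intervalIntegral.integral_const_mul]
    rw [h.eq_integral x hx]
    ring
  · simp only [Pi.smul_apply, smul_eq_mul, intervalIntegral.integral_const_mul]
    rw [h.deriv_eq_integral x hx]
    ring

/-- `f` lies in the domain of the Laplacian with Neumann (Kirchhoff) vertex conditions and satisfies
`-f'' = lam f` on every edge. Continuity at the vertices holds because `f` is a function on the
points of the graph, hence has one value at each vertex. -/
structure SolvesEigenEquation {V E : Type*} (Γ : MetricGraph V E) (lam : ℝ)
    (f : Γ.Point → ℂ) : Prop where
  edge_equation : ∀ e, ∃ p g : ℝ → ℂ, IsH2 (Γ.length e) (Γ.onEdge f e) p g ∧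
    ∀ᵐ x ∂(MeasureTheory.volume.restrict (Set.Icc 0 (Γ.length e))),
      -g x = (lam : ℂ) * Γ.onEdge f e x
  vertex_condition : ∀ v,
    HasSum (fun h : {h : E × Bool // Γ.endpt h.1 h.2 = v} => Γ.outDeriv f h.1.1 h.1.2) 0

theorem SolvesEigenEquation.differentiable {V E : Type*} {Γ : MetricGraph V E} {lam : ℝ}
    {f : Γ.Point → ℂ} (hf : Γ.SolvesEigenEquation lam f) (e : E) {x : ℝ}
    (hx : x ∈ Set.Icc 0 (Γ.length e)) :
    DifferentiableWithinAt ℝ (Γ.onEdge f e) (Set.Icc 0 (Γ.length e)) x := by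
  obtain ⟨p, g, h, -⟩ := hf.edge_equation e
  exact (h.differentiableWithinAt (Γ.length_pos e) hx).differentiableWithinAt

/-- The space of solutions of the eigenvalue equation; nonzero exactly if `lam` is an eigenvalue. -/
def eigenspace {V E : Type*} (Γ : MetricGraph V E) (lam : ℝ) : Submodule ℂ (Γ.Point → ℂ) where
  carrier := {f | Γ.SolvesEigenEquation lam f}
  zero_mem' := by
    have h0 : ∀ e, Γ.onEdge 0 e = 0 := fun e => rfl
    refine ⟨fun e => ⟨0, 0, ⟨MeasureTheory.MemLp.zero, ?_, ?_⟩, ?_⟩, fun v => ?_⟩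
    · simp [h0]
    · simp
    · simp [h0]
    · have : ∀ e b, Γ.outDeriv 0 e b = 0 := by
        intro e b
        cases b <;> simp [outDeriv, edgeDeriv, h0]
      simp only [this]
      exact hasSum_zero
  add_mem' := by
    intro f f' hf hf'
    refine ⟨fun e => ?_, fun v => ?_⟩
    · obtain ⟨p, g, h, hg⟩ := hf.edge_equation e
      obtain ⟨p', g', h', hg'⟩ := hf'.edge_equation e
      refine ⟨p + p', g + g', h.add (Γ.length_pos e) h', ?_⟩
      filter_upwards [hg, hg'] with x hx hx'
      have : Γ.onEdge (f + f') e x = Γ.onEdge f e x + Γ.onEdge f' e x := rfl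
      rw [this, mul_add, ← hx, ← hx', Pi.add_apply]
      ring
    · have key : ∀ e b, Γ.outDeriv (f + f') e b = Γ.outDeriv f e b + Γ.outDeriv f' e b := by
        intro e b
        have hs : Γ.onEdge (f + f') e = Γ.onEdge f e + Γ.onEdge f' e := rfl
        have hL := (Γ.length_pos e).le
        cases b
        · simp only [outDeriv, edgeDeriv, hs]
          exact derivWithin_add (hf.differentiable e (Set.left_mem_Icc.2 hL))
            (hf'.differentiable e (Set.left_mem_Icc.2 hL))
        · simp only [outDeriv, edgeDeriv, hs]
          rw [derivWithin_add (hf.differentiable e (Set.right_mem_Icc.2 hL))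
            (hf'.differentiable e (Set.right_mem_Icc.2 hL))]
          ring
      simp only [key]
      simpa using (hf.vertex_condition v).add (hf'.vertex_condition v)
  smul_mem' := by
    intro c f hf
    refine ⟨fun e => ?_, fun v => ?_⟩
    · obtain ⟨p, g, h, hg⟩ := hf.edge_equation e
      refine ⟨c • p, c • g, h.smul c, ?_⟩
      filter_upwards [hg] with x hx
      have : Γ.onEdge (c • f) e x = c * Γ.onEdge f e x := rfl
      rw [this, mul_left_comm, ← hx, Pi.smul_apply, smul_eq_mul]
      ring
    · have key : ∀ e b, Γ.outDeriv (c • f) e b = c * Γ.outDeriv f e b := by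
        intro e b
        have hs : Γ.onEdge (c • f) e = fun x => c * Γ.onEdge f e x := rfl
        have hL := (Γ.length_pos e).le
        cases b
        · simp only [outDeriv, edgeDeriv, hs]
          exact derivWithin_const_mul c (hf.differentiable e (Set.left_mem_Icc.2 hL))
        · simp only [outDeriv, edgeDeriv, hs]
          rw [derivWithin_const_mul c (hf.differentiable e (Set.right_mem_Icc.2 hL))]
          ring
      simp only [key]
      simpa using (hf.vertex_condition v).mul_left c

/-- `f` is an eigenfunction with eigenvalue `lam`. -/
def IsEigenfunction {V E : Type*} (Γ : MetricGraph V E) (lam : ℝ) (f : Γ.Point → ℂ) : Prop :=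
  f ∈ Γ.eigenspace lam ∧ f ≠ 0

/-- A generic eigenfunction: its eigenvalue is simple, it vanishes at no vertex, and none of its
outgoing derivatives vanishes at an interior vertex. -/
structure IsGenericEigenfunction {V E : Type*} (Γ : MetricGraph V E) (lam : ℝ)
    (f : Γ.Point → ℂ) : Prop where
  eigenfunction : Γ.IsEigenfunction lam f
  simple : Module.rank ℂ (Γ.eigenspace lam) = 1
  ne_zero_at_vertices : ∀ v, f (Point.vertex v) ≠ 0
  outDeriv_ne_zero : ∀ v, v ∉ Γ.boundary → ∀ e b, Γ.endpt e b = v → Γ.outDeriv f e b ≠ 0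

/-- The spectral position of `k ^ 2`: the number of eigenvalues in `[0, k ^ 2)`, each counted as many
times as its multiplicity. -/
def spectralPosition {V E : Type*} (Γ : MetricGraph V E) (k : ℝ) : ℕ∞ :=
  ∑' lam : Set.Ico (0 : ℝ) (k ^ 2), Cardinal.toENat (Module.rank ℂ (Γ.eigenspace lam))

/-- The wavelength capacity. -/
def wavelengthCapacity {V E : Type*} (Γ : MetricGraph V E) (k : ℝ) : ℝ :=
  Γ.totalLength * k / Real.pi

/-- The Neumann points of `f`: the points that are not vertices and where `f' = 0`. -/
def neumannPoints {V E : Type*} (Γ : MetricGraph V E) (f : Γ.Point → ℂ) : Set Γ.Point :=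
  {q | ∃ e x, ∃ hx : x ∈ Set.Ioo 0 (Γ.length e), q = Point.inner e x hx ∧ Γ.edgeDeriv f e x = 0}

/-- `C` is a Neumann domain of `f`: a connected component of the graph without the Neumann points
of `f`. -/
def IsNeumannDomain {V E : Type*} (Γ : MetricGraph V E) (f : Γ.Point → ℂ)
    (C : Set Γ.Point) : Prop :=
  ∃ q ∈ (Γ.neumannPoints f)ᶜ, C = connectedComponentIn (Γ.neumannPoints f)ᶜ q

/-- `x` is the coordinate, on the edge `e`, of an end of `e` or of a Neumann point of `f`. -/
def IsCut {V E : Type*} (Γ : MetricGraph V E) (f : Γ.Point → ℂ) (e : E) (x : ℝ) : Prop :=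
  x ∈ Set.Icc 0 (Γ.length e) ∧ (x = 0 ∨ x = Γ.length e ∨ Γ.pt e x ∈ Γ.neumannPoints f)

/-- A segment `[a, b]` of an edge whose ends are cuts and whose interior lies in the Neumann domain
`C` (so that there is no cut strictly between `a` and `b`). These are the edges of `C`. -/
structure Segment {V E : Type*} (Γ : MetricGraph V E) (f : Γ.Point → ℂ) (C : Set Γ.Point) where
  edge : E
  a : ℝ
  b : ℝ
  lt : a < b
  isCut_a : Γ.IsCut f edge a
  isCut_b : Γ.IsCut f edge b
  subset : ∀ x ∈ Set.Ioo a b, Γ.pt edge x ∈ C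

/-- The two ends of a segment, as coordinates on the edge that contains it. -/
def Segment.coord {V E : Type*} {Γ : MetricGraph V E} {f : Γ.Point → ℂ} {C : Set Γ.Point}
    (s : Γ.Segment f C) : Bool → ℝ
  | false => s.a
  | true => s.b

/-- The vertex at an end of a segment: the vertex of the ambient graph that lies there, if any;
otherwise the end is a Neumann point and gets a vertex of its own, so that the two sides of a Neumann
point are not attached to each other. -/
def Segment.endVertex {V E : Type*} {Γ : MetricGraph V E} {f : Γ.Point → ℂ} {C : Set Γ.Point}
    (s : Γ.Segment f C) (i : Bool) : V ⊕ (Γ.Segment f C × Bool) :=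
  match Γ.pt s.edge (s.coord i) with
  | Point.vertex v => Sum.inl v
  | Point.inner _ _ _ => Sum.inr (s, i)

/-- The Neumann domain `C` of `f` considered as a metric graph of its own. Its edges are the segments
into which the Neumann points cut the edges of the ambient graph and that lie in `C`; its vertices are
the vertices of the ambient graph in `C` and one vertex of degree one for each end of a segment at a
Neumann point. -/
def neumannDomainGraph {V E : Type*} (Γ : MetricGraph V E) (f : Γ.Point → ℂ) (C : Set Γ.Point) :
    MetricGraph
      {w : V ⊕ (Γ.Segment f C × Bool) // ∃ (s : Γ.Segment f C) (i : Bool), s.endVertex i = w}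
      (Γ.Segment f C) where
  endpt s i := ⟨s.endVertex i, s, i, rfl⟩
  length s := s.b - s.a
  length_pos s := sub_pos.2 s.lt

end MetricGraph

end

noncomputable section

/-! ### The equation -u'' = λu on a single edge. -/

namespace MetricGraph
open Set MeasureTheory

/-! Simplicity of the eigenvalue makes `f` real up to a constant, so on each edge it is a wave A
cos(k(x - y)) with real y. Since every edge is longer than π/k, each edge end sees a first extremum
inside its edge, at a distance r with 0 < kr ≤ π. Hence a Neumann domain is either a star around a
vertex with these r as arm lengths, or a segment of length π/k between consecutive Neumann points,
which is a star with one arm (`IsNeumannDomain.eq_starSet_or_openSegment`).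

Write θ for the numbers k times arm length. Since `f` does not vanish at the vertices, cos θ ≠ 0 on
every arm, and the Kirchhoff condition divided by k f(v) reads Σ tan θ = 0. Everything else concerns
stars with these two properties and θ ≤ π.

On a star with arms L_e, an eigenfunction for μ² is a_e cos(μt) on each arm, with t the distance
from the leaf. Away from the poles π/(2L_e), μ² is an eigenvalue exactly when Σ tan(μL_e) = 0, and
it is then simple; at a pole shared by m arms the multiplicity is m - 1. Between poles the sum of
tangents increases strictly, it vanishes at 0, and it vanishes again at k. So each pole below k is
preceded by exactly one zero, and every zero in [0, k) arises in this way. A pole with its zero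
contributes 1 + (m - 1) = m, and the spectral position N is the number of arms with θ > π/2
(`tsum_finrank_starCoeffs`).

If all θ < π, then Σ tan θ = 0 forces at least one θ above π/2 and at least one below, whence 1 ≤ N
≤ |∂Ω| - 1. The lower bound on Σ θ follows from superadditivity of the tangent
(`pi_div_two_mul_card_add_one_le`), the upper bound from the lower one by the reflection θ ↦ π - θ.
With a single arm θ = π, and all quantities are explicit. -/

theorem IsH2.hasDerivWithinAt_deriv {L : ℝ} {u p g : ℝ → ℂ} {c : ℂ} (hL : 0 < L) (h : IsH2 L u p g)
    (hg : ∀ᵐ x ∂(volume.restrict (Icc 0 L)), -g x = c * u x) {x : ℝ} (hx : x ∈ Icc 0 L) :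
    HasDerivWithinAt p (-(c * u x)) (Icc 0 L) x := by
  have hcu : ContinuousOn u (Icc 0 L) := fun y hy =>
    (h.differentiableWithinAt hL hy).continuousWithinAt
  have hc : ContinuousOn (fun t => -(c * u t)) (Icc 0 L) := (continuousOn_const.mul hcu).neg
  have : Fact (x ∈ Icc 0 L) := ⟨hx⟩
  have hI : IntervalIntegrable (fun t => -(c * u t)) volume 0 x :=
    (hc.mono (Icc_subset_Icc_right hx.2)).intervalIntegrable_of_Icc hx.1
  have hd := intervalIntegral.integral_hasDerivWithinAt_right (s := Icc 0 L)
    (t := Icc 0 L) hI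
    (hc.stronglyMeasurableAtFilter_nhdsWithin measurableSet_Icc x) (hc x hx)
  -- The weak equation replaces `g` by a continuous integrand, so the weak solution is a classical
  -- one.
  have he : ∀ y ∈ Icc 0 L, p y = p 0 + ∫ t in (0 : ℝ)..y, -(c * u t) := by
    intro y hy
    rw [h.deriv_eq_integral y hy]
    congr 1
    apply intervalIntegral.integral_congr_ae
    rw [ae_restrict_iff' measurableSet_Icc] at hg
    filter_upwards [hg] with t ht ht'
    rw [uIoc_of_le hy.1] at ht'
    rw [← ht ⟨ht'.1.le, ht'.2.trans hy.2⟩, neg_neg]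
  exact (hd.const_add (p 0)).congr he (he x hx)

theorem eq_of_hasDerivWithinAt_zero {L : ℝ} {u : ℝ → ℂ}
    (h : ∀ x ∈ Icc 0 L, HasDerivWithinAt u 0 (Icc 0 L) x) {x y : ℝ} (hx : x ∈ Icc 0 L)
    (hy : y ∈ Icc 0 L) : u x = u y := by
  have hc := constant_of_has_deriv_right_zero (f := u) (a := 0) (b := L)
    (fun x hx => (h x hx).continuousWithinAt)
    (fun x hx => ((h x (Ico_subset_Icc_self hx)).mono_of_mem_nhdsWithin
      (Icc_mem_nhdsGE_of_mem hx)))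
  rw [hc x hx, hc y hy]

theorem hasDerivAt_ofReal_cos (μ y x : ℝ) :
    HasDerivAt (fun x : ℝ => (Real.cos (μ * (x - y)) : ℂ)) (-(μ * Real.sin (μ * (x - y)) : ℂ)) x := by
  have h : HasDerivAt (fun x : ℝ => Real.cos (μ * (x - y))) (-Real.sin (μ * (x - y)) * (μ * 1)) x :=
    (((hasDerivAt_id x).sub_const y).const_mul μ).cos
  convert h.ofReal_comp using 1
  push_cast; ring

theorem hasDerivAt_ofReal_sin (μ y x : ℝ) :
    HasDerivAt (fun x : ℝ => (Real.sin (μ * (x - y)) : ℂ)) (μ * Real.cos (μ * (x - y)) : ℂ) x := by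
  have h : HasDerivAt (fun x : ℝ => Real.sin (μ * (x - y))) (Real.cos (μ * (x - y)) * (μ * 1)) x :=
    (((hasDerivAt_id x).sub_const y).const_mul μ).sin
  convert h.ofReal_comp using 1
  push_cast; ring

variable {V E : Type*} {Γ : MetricGraph V E}

theorem SolvesEigenEquation.hasDerivWithinAt {lam : ℝ} {f : Γ.Point → ℂ}
    (hf : Γ.SolvesEigenEquation lam f) (e : E) {x : ℝ} (hx : x ∈ Icc 0 (Γ.length e)) :
    HasDerivWithinAt (Γ.onEdge f e) (Γ.edgeDeriv f e x) (Icc 0 (Γ.length e)) x :=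
  (hf.differentiable e hx).hasDerivWithinAt

theorem SolvesEigenEquation.hasDerivWithinAt_edgeDeriv {lam : ℝ} {f : Γ.Point → ℂ}
    (hf : Γ.SolvesEigenEquation lam f) (e : E) {x : ℝ} (hx : x ∈ Icc 0 (Γ.length e)) :
    HasDerivWithinAt (Γ.edgeDeriv f e) (-(lam * Γ.onEdge f e x)) (Icc 0 (Γ.length e)) x := by
  obtain ⟨p, g, h, hg⟩ := hf.edge_equation e
  have hp : ∀ y ∈ Icc 0 (Γ.length e), Γ.edgeDeriv f e y = p y := fun y hy =>
    (h.differentiableWithinAt (Γ.length_pos e) hy).derivWithin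
      (uniqueDiffOn_Icc (Γ.length_pos e) y hy)
  exact (h.hasDerivWithinAt_deriv (Γ.length_pos e) hg hx).congr hp (hp x hx)

/-- Rotating the pair (μf, f') by the angle μ(x - y) gives two functions with derivative zero, and
undoing the rotation gives the formulas. The factor μ is kept so that μ = 0 needs no exception. -/
theorem SolvesEigenEquation.edge_solution {μ : ℝ} {f : Γ.Point → ℂ}
    (hf : Γ.SolvesEigenEquation (μ ^ 2) f) (e : E) {x y : ℝ} (hx : x ∈ Icc 0 (Γ.length e))
    (hy : y ∈ Icc 0 (Γ.length e)) :
    μ * Γ.onEdge f e x = μ * Γ.onEdge f e y * Real.cos (μ * (x - y)) +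
      Γ.edgeDeriv f e y * Real.sin (μ * (x - y)) ∧
    Γ.edgeDeriv f e x = Γ.edgeDeriv f e y * Real.cos (μ * (x - y)) -
      μ * Γ.onEdge f e y * Real.sin (μ * (x - y)) := by
  have hA := eq_of_hasDerivWithinAt_zero (L := Γ.length e)
    (u := fun x => μ * Γ.onEdge f e x * Real.cos (μ * (x - y)) -
      Γ.edgeDeriv f e x * Real.sin (μ * (x - y))) (fun z hz => by
      have := (((hf.hasDerivWithinAt e hz).const_mul (μ : ℂ)).mul
        (hasDerivAt_ofReal_cos μ y z).hasDerivWithinAt).sub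
        ((hf.hasDerivWithinAt_edgeDeriv e hz).mul (hasDerivAt_ofReal_sin μ y z).hasDerivWithinAt)
      refine this.congr_deriv ?_
      push_cast; ring) hx hy
  have hB := eq_of_hasDerivWithinAt_zero (L := Γ.length e)
    (u := fun x => μ * Γ.onEdge f e x * Real.sin (μ * (x - y)) +
      Γ.edgeDeriv f e x * Real.cos (μ * (x - y))) (fun z hz => by
      have := (((hf.hasDerivWithinAt e hz).const_mul (μ : ℂ)).mul
        (hasDerivAt_ofReal_sin μ y z).hasDerivWithinAt).add
        ((hf.hasDerivWithinAt_edgeDeriv e hz).mul (hasDerivAt_ofReal_cos μ y z).hasDerivWithinAt)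
      refine this.congr_deriv ?_
      push_cast; ring) hx hy
  simp only [sub_self, mul_zero, Real.cos_zero, Real.sin_zero, Complex.ofReal_one,
    Complex.ofReal_zero, mul_one, sub_zero, zero_add] at hA hB
  have hsc : (Real.sin (μ * (x - y)) : ℂ) ^ 2 + (Real.cos (μ * (x - y)) : ℂ) ^ 2 = 1 := by
    exact_mod_cast Real.sin_sq_add_cos_sq (μ * (x - y))
  constructor
  · linear_combination (Real.cos (μ * (x - y)) : ℂ) * hA + (Real.sin (μ * (x - y)) : ℂ) * hB -
      μ * Γ.onEdge f e x * hsc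
  · linear_combination (Real.cos (μ * (x - y)) : ℂ) * hB - (Real.sin (μ * (x - y)) : ℂ) * hA -
      Γ.edgeDeriv f e x * hsc

theorem SolvesEigenEquation.edge_solution_of_edgeDeriv_eq_zero {μ : ℝ} {f : Γ.Point → ℂ}
    (hf : Γ.SolvesEigenEquation (μ ^ 2) f) (e : E) {x y : ℝ} (hx : x ∈ Icc 0 (Γ.length e))
    (hy : y ∈ Icc 0 (Γ.length e)) (h0 : Γ.edgeDeriv f e y = 0) :
    Γ.onEdge f e x = Γ.onEdge f e y * Real.cos (μ * (x - y)) ∧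
    Γ.edgeDeriv f e x = -(μ * Γ.onEdge f e y * Real.sin (μ * (x - y))) := by
  have hs := hf.edge_solution e hx hy
  rw [h0] at hs
  refine ⟨?_, by rw [hs.2]; ring⟩
  -- For μ = 0 the factor μ cannot be cancelled; there f' vanishes identically and `f` is constant.
  -- The case matters because the eigenvalue 0 is counted.
  rcases eq_or_ne μ 0 with rfl | hμ
  · have : ∀ z ∈ Icc 0 (Γ.length e), Γ.edgeDeriv f e z = 0 := by
      intro z hz
      rw [(hf.edge_solution e hz hy).2, h0]; simp
    have := eq_of_hasDerivWithinAt_zero (fun z hz => this z hz ▸ hf.hasDerivWithinAt e hz) hx hy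
    simpa using this
  · have hμ' : (μ : ℂ) ≠ 0 := by exact_mod_cast hμ
    apply mul_left_cancel₀ hμ'
    rw [hs.1]; ring

theorem edgeDeriv_of_hasDerivAt {f : Γ.Point → ℂ} {e : E} {U P : ℝ → ℂ}
    (hU : ∀ x, HasDerivAt U (P x) x) (h : ∀ x ∈ Icc 0 (Γ.length e), Γ.onEdge f e x = U x)
    {x : ℝ} (hx : x ∈ Icc 0 (Γ.length e)) : Γ.edgeDeriv f e x = P x :=
  ((hU x).hasDerivWithinAt.congr h (h x hx)).derivWithin (uniqueDiffOn_Icc (Γ.length_pos e) x hx)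

/-- The converse passage, from classical to weak solutions, used whenever an eigenfunction is
constructed by hand. -/
theorem edge_equation_of_hasDerivAt {f : Γ.Point → ℂ} {e : E} {U P : ℝ → ℂ} {lam : ℝ}
    (hU : ∀ x, HasDerivAt U (P x) x) (hP : ∀ x, HasDerivAt P (-(lam * U x)) x)
    (h : ∀ x ∈ Icc 0 (Γ.length e), Γ.onEdge f e x = U x) :
    ∃ p g : ℝ → ℂ, IsH2 (Γ.length e) (Γ.onEdge f e) p g ∧
      ∀ᵐ x ∂(volume.restrict (Icc 0 (Γ.length e))), -g x = (lam : ℂ) * Γ.onEdge f e x := by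
  have hUc : Continuous U := continuous_iff_continuousAt.2 fun x => (hU x).continuousAt
  have hPc : Continuous P := continuous_iff_continuousAt.2 fun x => (hP x).continuousAt
  have hGc : Continuous fun x => -((lam : ℂ) * U x) := (continuous_const.mul hUc).neg
  have h0 : (0 : ℝ) ∈ Icc 0 (Γ.length e) := left_mem_Icc.2 (Γ.length_pos e).le
  refine ⟨P, fun x => -(lam * U x), ⟨?_, fun x hx => ?_, fun x hx => ?_⟩, ?_⟩
  · obtain ⟨C, hC⟩ := isCompact_Icc.exists_bound_of_continuousOn
      (hGc.continuousOn (s := Icc 0 (Γ.length e)))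
    refine MemLp.of_bound hGc.aestronglyMeasurable C ?_
    filter_upwards [ae_restrict_mem measurableSet_Icc] with x hx using hC x hx
  · rw [h x hx, h 0 h0, intervalIntegral.integral_eq_sub_of_hasDerivAt (fun y _ => hU y)
      (hPc.intervalIntegrable _ _)]
    ring
  · rw [intervalIntegral.integral_eq_sub_of_hasDerivAt (fun y _ => hP y)
      (hGc.intervalIntegrable _ _)]
    ring
  · filter_upwards [ae_restrict_mem measurableSet_Icc] with x hx
    rw [h x hx, neg_neg]

/-! ### Edge ends, and functions glued from edges and vertices. -/

theorem pt_zero (e : E) : Γ.pt e 0 = Point.vertex (Γ.endpt e false) := by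
  simp [pt]

theorem pt_length (e : E) : Γ.pt e (Γ.length e) = Point.vertex (Γ.endpt e true) := by
  simp [pt, Γ.length_pos e]

theorem pt_of_mem_Ioo {e : E} {x : ℝ} (hx : x ∈ Ioo 0 (Γ.length e)) :
    Γ.pt e x = Point.inner e x hx := by
  simp only [pt, dif_pos hx]

/-- The coordinate of an end of an edge. -/
def endCoord (Γ : MetricGraph V E) (e : E) : Bool → ℝ
  | false => 0
  | true => Γ.length e

theorem endCoord_mem (e : E) (b : Bool) : Γ.endCoord e b ∈ Icc 0 (Γ.length e) := by
  cases b
  · exact left_mem_Icc.2 (Γ.length_pos e).le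
  · exact right_mem_Icc.2 (Γ.length_pos e).le

theorem pt_endCoord (e : E) (b : Bool) : Γ.pt e (Γ.endCoord e b) = Point.vertex (Γ.endpt e b) := by
  cases b
  · exact pt_zero e
  · exact pt_length e

theorem onEdge_endCoord (f : Γ.Point → ℂ) (e : E) (b : Bool) :
    Γ.onEdge f e (Γ.endCoord e b) = f (Point.vertex (Γ.endpt e b)) := by
  rw [onEdge, pt_endCoord]

theorem outDeriv_eq (f : Γ.Point → ℂ) (e : E) (b : Bool) :
    Γ.outDeriv f e b = (if b then -1 else 1) * Γ.edgeDeriv f e (Γ.endCoord e b) := by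
  cases b <;> simp [outDeriv, endCoord]

theorem eq_endCoord_or_mem_Ioo {e : E} {x : ℝ} (hx : x ∈ Icc 0 (Γ.length e)) :
    x ∈ Ioo 0 (Γ.length e) ∨ ∃ b, x = Γ.endCoord e b := by
  rcases eq_endpoints_or_mem_Ioo_of_mem_Icc hx with h | h | h
  · exact Or.inr ⟨false, h⟩
  · exact Or.inr ⟨true, h⟩
  · exact Or.inl h

theorem pt_eq_vertex_iff {e : E} {x : ℝ} (hx : x ∈ Icc 0 (Γ.length e)) (v : V) :
    Γ.pt e x = Point.vertex v ↔ ∃ b, x = Γ.endCoord e b ∧ Γ.endpt e b = v := by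
  constructor
  · intro h
    rcases eq_endCoord_or_mem_Ioo hx with hx | ⟨b, rfl⟩
    · rw [pt_of_mem_Ioo hx] at h
      cases h
    · rw [pt_endCoord] at h
      exact ⟨b, rfl, Point.vertex.inj h⟩
  · rintro ⟨b, rfl, rfl⟩
    exact pt_endCoord e b

/-- The function on a metric graph with given values at the vertices and on the open edges. -/
def glue (Γ : MetricGraph V E) (h : V → ℂ) (U : E → ℝ → ℂ) : Γ.Point → ℂ
  | Point.vertex v => h v
  | Point.inner e x _ => U e x

theorem onEdge_glue {h : V → ℂ} {U : E → ℝ → ℂ} {e : E}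
    (hb : ∀ b, U e (Γ.endCoord e b) = h (Γ.endpt e b)) {x : ℝ} (hx : x ∈ Icc 0 (Γ.length e)) :
    Γ.onEdge (Γ.glue h U) e x = U e x := by
  rcases eq_endCoord_or_mem_Ioo hx with hx | ⟨b, rfl⟩
  · rw [onEdge, pt_of_mem_Ioo hx]; rfl
  · rw [onEdge, pt_endCoord, hb]; rfl

theorem edgeDeriv_eq_of_eqOn {f : Γ.Point → ℂ} {e : E} {A : ℂ} {μ y : ℝ}
    (h : ∀ x ∈ Icc 0 (Γ.length e), Γ.onEdge f e x = A * Real.cos (μ * (x - y)))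
    {x : ℝ} (hx : x ∈ Icc 0 (Γ.length e)) :
    Γ.edgeDeriv f e x = -(μ * A * Real.sin (μ * (x - y))) := by
  rw [edgeDeriv_of_hasDerivAt (fun x => (hasDerivAt_ofReal_cos μ y x).const_mul A) h hx]
  ring

theorem edge_equation_of_eqOn {f : Γ.Point → ℂ} {e : E} {A : ℂ} {μ y : ℝ}
    (h : ∀ x ∈ Icc 0 (Γ.length e), Γ.onEdge f e x = A * Real.cos (μ * (x - y))) :
    ∃ p g : ℝ → ℂ, IsH2 (Γ.length e) (Γ.onEdge f e) p g ∧
      ∀ᵐ x ∂(volume.restrict (Icc 0 (Γ.length e))),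
        -g x = ((μ ^ 2 : ℝ) : ℂ) * Γ.onEdge f e x := by
  refine edge_equation_of_hasDerivAt (fun x => (hasDerivAt_ofReal_cos μ y x).const_mul A)
    (fun x => ?_) h
  have := (((hasDerivAt_ofReal_sin μ y x).const_mul (μ : ℂ)).neg).const_mul A
  refine this.congr_deriv ?_
  push_cast; ring

end MetricGraph

/-! ### Eigenspaces of star graphs. -/

namespace MetricGraph
open Set MeasureTheory

/-- A star graph with center `c`: each edge `e` joins `c`, at its end `τ e`, to a leaf of its own. -/
structure IsStar {V E : Type*} (G : MetricGraph V E) (c : V) (τ : E → Bool) : Prop where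
  endpt_center : ∀ e, G.endpt e (τ e) = c
  endpt_leaf_ne : ∀ e, G.endpt e (!τ e) ≠ c
  leaf_injective : Function.Injective fun e => G.endpt e (!τ e)
  eq_center_or_leaf : ∀ v, v = c ∨ ∃ e, G.endpt e (!τ e) = v

/-- Coefficients `a e` such that the functions `a e * cos (μ t)`, with `t` the distance from the leaf
of `e`, have a common value and derivatives summing to zero at the center of a star. -/
def starCoeffs {E : Type*} [Fintype E] (L : E → ℝ) (μ : ℝ) : Submodule ℂ (E → ℂ) where
  carrier := {a | (∀ e e', a e * Real.cos (μ * L e) = a e' * Real.cos (μ * L e')) ∧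
    ∑ e, μ * a e * Real.sin (μ * L e) = 0}
  zero_mem' := by simp
  add_mem' := by
    rintro a b ⟨ha, ha'⟩ ⟨hb, hb'⟩
    refine ⟨fun e e' => ?_, ?_⟩
    · simp only [Pi.add_apply, add_mul, ha e e', hb e e']
    · simp only [Pi.add_apply, mul_add, add_mul, Finset.sum_add_distrib, ha', hb', add_zero]
  smul_mem' := by
    rintro c a ⟨ha, ha'⟩
    refine ⟨fun e e' => ?_, ?_⟩
    · simp only [Pi.smul_apply, smul_eq_mul, mul_assoc, ha e e']
    · have : ∀ e, (μ : ℂ) * (c • a) e * Real.sin (μ * L e) = c * (μ * a e * Real.sin (μ * L e)) := by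
        intro e; simp only [Pi.smul_apply, smul_eq_mul]; ring
      simp only [this, ← Finset.mul_sum, ha', mul_zero]

namespace IsStar

variable {V E : Type*} {G : MetricGraph V E} {c : V} {τ : E → Bool}

theorem eq_of_endpt_eq_center (h : G.IsStar c τ) {e : E} {b : Bool} (hb : G.endpt e b = c) :
    b = τ e := by
  by_contra hne
  have : b = !τ e := by cases b <;> cases hτ : τ e <;> simp_all
  exact h.endpt_leaf_ne e (this ▸ hb)

theorem eq_of_endpt_eq_leaf (h : G.IsStar c τ) {e e' : E} {b : Bool}
    (hb : G.endpt e' b = G.endpt e (!τ e)) : e' = e ∧ b = !τ e := by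
  have hne : b ≠ τ e' := by
    rintro rfl
    exact h.endpt_leaf_ne e (hb.symm.trans (h.endpt_center e'))
  have hb' : b = !τ e' := by cases b <;> cases hτ : τ e' <;> simp_all
  have : e' = e := h.leaf_injective (by simpa [hb'] using hb)
  exact ⟨this, by rw [hb', this]⟩

/-- The edge ends at the center of a star. -/
def centerEquiv (h : G.IsStar c τ) : E ≃ {p : E × Bool // G.endpt p.1 p.2 = c} where
  toFun e := ⟨(e, τ e), h.endpt_center e⟩
  invFun p := p.1.1
  left_inv e := rfl
  right_inv := by
    rintro ⟨⟨e, b⟩, hb⟩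
    have hb' : b = τ e := h.eq_of_endpt_eq_center hb
    simp [hb']

/-- The only edge end at a leaf of a star. -/
@[reducible]
def leafUnique (h : G.IsStar c τ) (e : E) :
    Unique {p : E × Bool // G.endpt p.1 p.2 = G.endpt e (!τ e)} where
  default := ⟨(e, !τ e), rfl⟩
  uniq := by
    rintro ⟨⟨e', b⟩, hb⟩
    obtain ⟨rfl, rfl⟩ : e' = e ∧ b = !τ e := h.eq_of_endpt_eq_leaf hb
    rfl

theorem degree_center (h : G.IsStar c τ) : G.degree c = Nat.card E :=
  (Nat.card_congr h.centerEquiv).symm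

theorem degree_leaf (h : G.IsStar c τ) (e : E) : G.degree (G.endpt e (!τ e)) = 1 := by
  have := h.leafUnique e
  exact Nat.card_unique

/-- The degree of the center is the number of arms, so the center joins the leaves in the boundary
only when there is a single arm. -/
theorem boundary_encard [Fintype E] (h : G.IsStar c τ) (hc : Fintype.card E ≠ 1) :
    G.boundary.encard = Fintype.card E := by
  have : G.boundary = range fun e => G.endpt e (!τ e) := by
    ext v
    constructor
    · intro hv
      rcases h.eq_center_or_leaf v with rfl | ⟨e, rfl⟩
      · exact absurd (h.degree_center.symm.trans hv) (by simpa [Nat.card_eq_fintype_card])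
      · exact ⟨e, rfl⟩
    · rintro ⟨e, rfl⟩
      exact h.degree_leaf e
  rw [this, ← image_univ, h.leaf_injective.encard_image]
  simp

theorem boundary_encard_of_card_eq_one [Fintype E] (h : G.IsStar c τ) (hc : Fintype.card E = 1) :
    G.boundary.encard = 2 := by
  obtain ⟨e, he⟩ := Fintype.card_eq_one_iff.1 hc
  have : G.boundary = {c, G.endpt e (!τ e)} := by
    ext v
    constructor
    · intro _
      rcases h.eq_center_or_leaf v with rfl | ⟨e', rfl⟩
      · simp
      · simp [he e']
    · rintro (rfl | rfl)
      · exact h.degree_center.trans (by rw [Nat.card_eq_fintype_card, hc])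
      · exact h.degree_leaf e
  rw [this, encard_pair (h.endpt_leaf_ne e).symm]

theorem hasSum_center_iff [Fintype E] (h : G.IsStar c τ) (f : G.Point → ℂ) :
    HasSum (fun p : {p : E × Bool // G.endpt p.1 p.2 = c} => G.outDeriv f p.1.1 p.1.2) 0 ↔
      ∑ e, G.outDeriv f e (τ e) = 0 := by
  rw [← h.centerEquiv.hasSum_iff]
  constructor
  · intro hs
    exact (hasSum_fintype _).unique hs
  · intro hs
    rw [← hs]
    exact hasSum_fintype _

theorem hasSum_leaf_iff (h : G.IsStar c τ) (f : G.Point → ℂ) (e : E) :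
    HasSum (fun p : {p : E × Bool // G.endpt p.1 p.2 = G.endpt e (!τ e)} =>
      G.outDeriv f p.1.1 p.1.2) 0 ↔ G.outDeriv f e (!τ e) = 0 := by
  have := h.leafUnique e
  have hs : HasSum (fun p : {p : E × Bool // G.endpt p.1 p.2 = G.endpt e (!τ e)} =>
      G.outDeriv f p.1.1 p.1.2) (G.outDeriv f e (!τ e)) := by
    convert hasSum_unique _ using 1
    rw [Subsingleton.elim default
      (⟨(e, !τ e), rfl⟩ : {p : E × Bool // G.endpt p.1 p.2 = G.endpt e (!τ e)})]
  constructor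
  · intro h0
    exact hs.unique h0
  · intro h0
    rwa [h0] at hs

theorem outDeriv_eq_zero_iff (f : G.Point → ℂ) (e : E) (b : Bool) :
    G.outDeriv f e b = 0 ↔ G.edgeDeriv f e (G.endCoord e b) = 0 := by
  rw [outDeriv_eq]
  cases b <;> simp

theorem cos_endCoord_sub (e : E) (b : Bool) (μ : ℝ) :
    Real.cos (μ * (G.endCoord e b - G.endCoord e (!b))) = Real.cos (μ * G.length e) := by
  cases b <;> simp [endCoord]

theorem sin_endCoord_sub (e : E) (b : Bool) (μ : ℝ) :
    Real.sin (μ * (G.endCoord e b - G.endCoord e (!b))) =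
      (if b then 1 else -1) * Real.sin (μ * G.length e) := by
  cases b <;> simp [endCoord]

theorem outDeriv_center {f : G.Point → ℂ} {e : E} {b : Bool} {A : ℂ} {μ : ℝ}
    (hA : G.edgeDeriv f e (G.endCoord e b) =
      -(μ * A * Real.sin (μ * (G.endCoord e b - G.endCoord e (!b))))) :
    G.outDeriv f e b = μ * A * Real.sin (μ * G.length e) := by
  rw [outDeriv_eq, hA, sin_endCoord_sub]
  cases b <;> simp

/-- The vertex condition at a leaf is f' = 0, so the value at the leaf determines `f` on the whole
arm, up to and including the center. -/
theorem coeffs_of_mem (h : G.IsStar c τ) {f : G.Point → ℂ} {μ : ℝ}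
    (hf : f ∈ G.eigenspace (μ ^ 2)) (e : E) :
    (∀ x ∈ Icc 0 (G.length e), G.onEdge f e x = f (Point.vertex (G.endpt e (!τ e))) *
      Real.cos (μ * (x - G.endCoord e (!τ e)))) ∧
    f (Point.vertex c) = f (Point.vertex (G.endpt e (!τ e))) * Real.cos (μ * G.length e) ∧
    G.outDeriv f e (τ e) =
      μ * f (Point.vertex (G.endpt e (!τ e))) * Real.sin (μ * G.length e) := by
  have hf : G.SolvesEigenEquation (μ ^ 2) f := hf
  have h0 := (outDeriv_eq_zero_iff f e _).1
    ((h.hasSum_leaf_iff f e).1 (hf.vertex_condition (G.endpt e (!τ e))))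
  have hs := fun x hx => hf.edge_solution_of_edgeDeriv_eq_zero e (x := x) hx
    (G.endCoord_mem e (!τ e)) h0
  simp only [onEdge_endCoord] at hs
  refine ⟨fun x hx => (hs x hx).1, ?_, outDeriv_center (hs _ (endCoord_mem e (τ e))).2⟩
  have := (hs _ (endCoord_mem e (τ e))).1
  rwa [onEdge_endCoord, h.endpt_center, cos_endCoord_sub] at this

theorem exists_of_mem_starCoeffs [Fintype E] [Nonempty E] (h : G.IsStar c τ) {a : E → ℂ} {μ : ℝ}
    (ha : a ∈ starCoeffs G.length μ) :
    ∃ f ∈ G.eigenspace (μ ^ 2), ∀ e, f (Point.vertex (G.endpt e (!τ e))) = a e := by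
  obtain ⟨e₀⟩ := ‹Nonempty E›
  -- The only vertex that is not a leaf is the center, so the default value of the extension is the
  -- value there. The choice of `e₀` is immaterial because all arms give the same value at the
  -- center.
  set H : V → ℂ := Function.extend (fun e => G.endpt e (!τ e)) a
    (fun _ => a e₀ * Real.cos (μ * G.length e₀)) with hH
  have hleaf : ∀ e, H (G.endpt e (!τ e)) = a e := fun e => h.leaf_injective.extend_apply _ _ e
  have hcen : ∀ e, H (G.endpt e (τ e)) = a e * Real.cos (μ * G.length e) := by
    intro e
    rw [h.endpt_center, ha.1 e e₀]
    exact Function.extend_apply' _ _ _ fun ⟨e, he⟩ => h.endpt_leaf_ne e he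
  set U : E → ℝ → ℂ := fun e x => a e * Real.cos (μ * (x - G.endCoord e (!τ e))) with hU
  have hglue : ∀ e, ∀ x ∈ Icc 0 (G.length e), G.onEdge (G.glue H U) e x = U e x := by
    intro e x hx
    refine onEdge_glue (fun b => ?_) hx
    by_cases hb : b = τ e
    · subst hb
      rw [hcen, hU]
      simp only [cos_endCoord_sub]
    · have : b = !τ e := by cases b <;> cases hτ : τ e <;> simp_all
      rw [this, hleaf, hU]
      simp
  have hder : ∀ e b, G.edgeDeriv (G.glue H U) e (G.endCoord e b) = _ := fun e b =>
    edgeDeriv_eq_of_eqOn (hglue e) (endCoord_mem e b)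
  refine ⟨G.glue H U, ⟨fun e => edge_equation_of_eqOn (hglue e), fun v => ?_⟩, hleaf⟩
  rcases h.eq_center_or_leaf v with rfl | ⟨e, rfl⟩
  · rw [h.hasSum_center_iff]
    simp only [outDeriv_center (hder _ (τ _))]
    exact ha.2
  · rw [h.hasSum_leaf_iff, outDeriv_eq_zero_iff, hder]
    simp

/-- Eigenfunctions on a star graph correspond to their values at the leaves. -/
theorem nonempty_eigenspace_equiv [Fintype E] [Nonempty E] (h : G.IsStar c τ) (μ : ℝ) :
    Nonempty (G.eigenspace (μ ^ 2) ≃ₗ[ℂ] starCoeffs G.length μ) := by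
  let Φ : G.eigenspace (μ ^ 2) →ₗ[ℂ] starCoeffs G.length μ :=
    { toFun := fun f => ⟨fun e => f.1 (Point.vertex (G.endpt e (!τ e))), by
        refine ⟨fun e e' => ?_, ?_⟩
        · rw [← (h.coeffs_of_mem f.2 e).2.1, ← (h.coeffs_of_mem f.2 e').2.1]
        · simp only [← (h.coeffs_of_mem f.2 _).2.2]
          exact (h.hasSum_center_iff _).1 (f.2.vertex_condition c)⟩
      map_add' := fun _ _ => rfl
      map_smul' := fun _ _ => rfl }
  refine ⟨LinearEquiv.ofBijective Φ ⟨?_, ?_⟩⟩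
  · rw [injective_iff_map_eq_zero]
    rintro f hf
    have h0 : ∀ e, f.1 (Point.vertex (G.endpt e (!τ e))) = 0 := fun e =>
      congrFun (congrArg Subtype.val hf) e
    ext q
    show f.1 q = 0
    cases q with
    | vertex v =>
      rcases h.eq_center_or_leaf v with rfl | ⟨e, rfl⟩
      · obtain ⟨e⟩ := ‹Nonempty E›
        rw [(h.coeffs_of_mem f.2 e).2.1, h0, zero_mul]
      · exact h0 e
    | inner e x hx =>
      have := (h.coeffs_of_mem f.2 e).1 x (Ioo_subset_Icc_self hx)
      rwa [h0, zero_mul, onEdge, pt_of_mem_Ioo hx] at this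
  · rintro ⟨a, ha⟩
    obtain ⟨f, hf, hfa⟩ := h.exists_of_mem_starCoeffs ha
    exact ⟨⟨f, hf⟩, Subtype.ext (funext hfa)⟩

theorem toENat_rank_eigenspace [Fintype E] [Nonempty E] (h : G.IsStar c τ) (μ : ℝ) :
    Cardinal.toENat (Module.rank ℂ (G.eigenspace (μ ^ 2))) =
      Module.finrank ℂ (starCoeffs G.length μ) := by
  obtain ⟨Φ⟩ := h.nonempty_eigenspace_equiv μ
  have : Module.Finite ℂ (G.eigenspace (μ ^ 2)) := Module.Finite.equiv Φ.symm
  rw [← Φ.finrank_eq, ← Module.finrank_eq_rank, map_natCast]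

end IsStar

/-! ### The multiplicity of an eigenvalue of a star. -/

section finrank

variable {E : Type*} [Fintype E] {L : E → ℝ} {μ : ℝ}

/-- The common value s at the center determines every coefficient as s / cos(μL_e), and the
derivative condition becomes sμ Σ tan(μL_e) = 0. -/
theorem finrank_starCoeffs_of_forall_cos_ne_zero [Nonempty E] (hc : ∀ e, Real.cos (μ * L e) ≠ 0) :
    Module.finrank ℂ (starCoeffs L μ) = if μ = 0 ∨ ∑ e, Real.tan (μ * L e) = 0 then 1 else 0 := by
  have hc' : ∀ e, (Real.cos (μ * L e) : ℂ) ≠ 0 := fun e => by exact_mod_cast hc e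
  obtain ⟨e₀⟩ := ‹Nonempty E›
  set w : E → ℂ := fun e => (Real.cos (μ * L e) : ℂ)⁻¹ with hw
  have hsum : ∀ s : ℂ, ∑ e, μ * (s * w e) * Real.sin (μ * L e) =
      s * (μ * ((∑ e, Real.tan (μ * L e) : ℝ) : ℂ)) := by
    intro s
    simp only [Complex.ofReal_sum, Finset.mul_sum, Real.tan_eq_sin_div_cos, Complex.ofReal_div]
    refine Finset.sum_congr rfl fun e _ => ?_
    rw [hw]; field_simp
  have hmem : ∀ a ∈ starCoeffs L μ, a = (a e₀ * Real.cos (μ * L e₀)) • w := by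
    intro a ha
    ext e
    rw [Pi.smul_apply, smul_eq_mul, ← ha.1 e e₀, hw, mul_assoc, mul_inv_cancel₀ (hc' e), mul_one]
  split_ifs with h0
  · have hW : starCoeffs L μ = ℂ ∙ w := by
      apply le_antisymm
      · intro a ha
        rw [hmem a ha]
        exact Submodule.smul_mem _ _ (Submodule.mem_span_singleton_self w)
      · rw [Submodule.span_singleton_le_iff_mem]
        refine ⟨fun e e' => ?_, ?_⟩
        · simp only [hw]
          rw [inv_mul_cancel₀ (hc' e), inv_mul_cancel₀ (hc' e')]
        · have := hsum 1
          simp only [one_mul] at this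
          rw [this]
          rcases h0 with h0 | h0 <;> simp [h0]
    rw [hW]
    refine finrank_span_singleton fun h => ?_
    exact inv_ne_zero (hc' e₀) (congrFun h e₀)
  · push Not at h0
    have hW : starCoeffs L μ = ⊥ := by
      rw [eq_bot_iff]
      intro a ha
      have hs := ha.2
      rw [hmem a ha] at hs ⊢
      simp only [Pi.smul_apply, smul_eq_mul] at hs
      rw [hsum, mul_eq_zero] at hs
      rcases hs with hs | hs
      · rw [hs, zero_smul]; exact Submodule.zero_mem _
      · exfalso
        rw [mul_eq_zero] at hs
        exact hs.elim (by exact_mod_cast h0.1) (by exact_mod_cast h0.2)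
    rw [hW, finrank_bot]

/-- One vanishing cosine forces the value 0 at the center. This kills the coefficients with nonzero
cosine and leaves the others free up to the derivative condition, which is nontrivial because the
sine is nonzero where the cosine vanishes. -/
theorem finrank_starCoeffs_of_exists_cos_eq_zero (hμ : μ ≠ 0)
    (hc : ∃ e, Real.cos (μ * L e) = 0) :
    Module.finrank ℂ (starCoeffs L μ) + 1 = Nat.card {e // Real.cos (μ * L e) = 0} := by
  classical
  obtain ⟨e₀, he₀⟩ := hc
  have hs₀ : (Real.sin (μ * L e₀) : ℂ) ≠ 0 := by
    have := Real.sin_sq_add_cos_sq (μ * L e₀)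
    intro h
    have h : Real.sin (μ * L e₀) = 0 := by exact_mod_cast h
    simp [he₀, h] at this
  have hμ' : (μ : ℂ) ≠ 0 := by exact_mod_cast hμ
  -- `Ψ` collects the coordinates forced to vanish and the derivative sum. It is surjective with
  -- kernel `starCoeffs L μ`, so rank-nullity gives the dimension.
  let Ψ : (E → ℂ) →ₗ[ℂ] ({e // Real.cos (μ * L e) ≠ 0} → ℂ) × ℂ :=
    { toFun := fun a => (fun e => a e.1, ∑ e, μ * a e * Real.sin (μ * L e))
      map_add' := fun a b => by
        ext <;> simp [mul_add, add_mul, Finset.sum_add_distrib]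
      map_smul' := fun s a => by
        ext
        · simp
        · simp only [Pi.smul_apply, smul_eq_mul, RingHom.id_apply, Prod.smul_mk, Finset.mul_sum]
          exact Finset.sum_congr rfl fun e _ => by ring }
  have hker : LinearMap.ker Ψ = starCoeffs L μ := by
    ext a
    rw [LinearMap.mem_ker]
    constructor
    · intro h
      have h1 : ∀ e, Real.cos (μ * L e) ≠ 0 → a e = 0 := fun e he =>
        congrFun (congrArg Prod.fst h) ⟨e, he⟩
      have h2 : ∀ e, a e * Real.cos (μ * L e) = 0 := by
        intro e
        by_cases he : Real.cos (μ * L e) = 0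
        · simp [he]
        · simp [h1 e he]
      exact ⟨fun e e' => by rw [h2, h2], congrArg Prod.snd h⟩
    · rintro ⟨h1, h2⟩
      refine Prod.ext (funext fun e => ?_) h2
      have := h1 e e₀
      rw [he₀, Complex.ofReal_zero, mul_zero, mul_eq_zero] at this
      exact this.resolve_right (by exact_mod_cast e.2)
  have hsurj : Function.Surjective Ψ := by
    rintro ⟨d, s⟩
    let a₁ : E → ℂ := fun e => if he : Real.cos (μ * L e) ≠ 0 then d ⟨e, he⟩ else 0
    -- The coordinate at `e₀` is not recorded in the first component, so it can be used to correct
    -- the sum.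
    let t : ℂ := (s - ∑ e, μ * a₁ e * Real.sin (μ * L e)) / (μ * Real.sin (μ * L e₀))
    refine ⟨a₁ + Pi.single e₀ t, ?_⟩
    refine Prod.ext (funext fun e => ?_) ?_
    · have hne : e.1 ≠ e₀ := fun h => e.2 (h ▸ he₀)
      have he : Real.cos (μ * L e.1) ≠ 0 := e.2
      show a₁ e.1 + (Pi.single e₀ t : E → ℂ) e.1 = d e
      rw [Pi.single_eq_of_ne hne, add_zero]
      simp only [a₁, dif_pos he]
    · show ∑ e, μ * (a₁ e + (Pi.single e₀ t : E → ℂ) e) * Real.sin (μ * L e) = s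
      simp only [mul_add, add_mul, Finset.sum_add_distrib]
      rw [Finset.sum_eq_single (f := fun e => μ * (Pi.single e₀ t : E → ℂ) e *
        Real.sin (μ * L e)) e₀ (fun e _ hne => by rw [Pi.single_eq_of_ne hne]; simp)
        (by simp), Pi.single_eq_same]
      simp only [t]
      field_simp
      ring
  have hrn := LinearMap.finrank_range_add_finrank_ker Ψ
  rw [LinearMap.range_eq_top.2 hsurj, finrank_top, hker, Module.finrank_prod,
    Module.finrank_fintype_fun_eq_card, Module.finrank_fintype_fun_eq_card,
    Module.finrank_self] at hrn
  have hcard := Fintype.card_subtype_compl (fun e => Real.cos (μ * L e) = 0)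
  have hle := Fintype.card_subtype_le (fun e => Real.cos (μ * L e) = 0)
  rw [Nat.card_eq_fintype_card]
  simp only [ne_eq] at hrn
  omega

end finrank

end MetricGraph

/-! ### Counting eigenvalues of a star by zeros and poles of a sum of tangents. -/

namespace MetricGraph
open Set MeasureTheory

theorem tan_lt_tan_of_lt {x y : ℝ} (hx : 0 ≤ x) (hxy : x < y) (hy : y ≤ Real.pi)
    (h : ¬ (x ≤ Real.pi / 2 ∧ Real.pi / 2 ≤ y)) : Real.tan x < Real.tan y := by
  have hπ := Real.pi_pos
  by_cases hx' : x ≤ Real.pi / 2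
  · have hy' : y < Real.pi / 2 := by
      by_contra hy'
      exact h ⟨hx', not_lt.1 hy'⟩
    exact Real.tan_lt_tan_of_lt_of_lt_pi_div_two (by linarith) hy' hxy
  · rw [not_le] at hx'
    rw [← Real.tan_sub_pi x, ← Real.tan_sub_pi y]
    exact Real.tan_lt_tan_of_lt_of_lt_pi_div_two (by linarith) (by linarith) (by linarith)

theorem cos_eq_zero_iff_of_mem {x : ℝ} (hx : 0 ≤ x) (hx' : x ≤ Real.pi) :
    Real.cos x = 0 ↔ x = Real.pi / 2 := by
  have hπ := Real.pi_pos
  constructor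
  · intro h
    exact Real.injOn_cos ⟨hx, hx'⟩ ⟨by linarith, by linarith⟩ (by rw [h, Real.cos_pi_div_two])
  · rintro rfl
    exact Real.cos_pi_div_two

/-- When kL ≤ π, the number π/(2L) is the only possible pole of tan(xL) for x in [0, k]. -/
theorem le_pole_iff {E : Type*} {L : E → ℝ} (hL : ∀ e, 0 < L e) (e : E) (x : ℝ) :
    x ≤ Real.pi / (2 * L e) ↔ x * L e ≤ Real.pi / 2 := by
  have := hL e
  rw [le_div_iff₀ (by positivity)]
  constructor <;> intro h <;> linarith

theorem pole_le_iff {E : Type*} {L : E → ℝ} (hL : ∀ e, 0 < L e) (e : E) (x : ℝ) :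
    Real.pi / (2 * L e) ≤ x ↔ Real.pi / 2 ≤ x * L e := by
  have := hL e
  rw [div_le_iff₀ (by positivity)]
  constructor <;> intro h <;> linarith

theorem tan_mul_le_tan_mul {E : Type*} {L : E → ℝ} {k : ℝ} (hL : ∀ e, 0 < L e)
    (hk : ∀ e, k * L e ≤ Real.pi) {a b : ℝ}
    (ha : 0 ≤ a) (hab : a ≤ b) (hb : b ≤ k) (e : E)
    (h : ¬ (a ≤ Real.pi / (2 * L e) ∧ Real.pi / (2 * L e) ≤ b)) :
    Real.tan (a * L e) ≤ Real.tan (b * L e) := by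
  rcases hab.eq_or_lt with rfl | hab
  · exact le_rfl
  · rw [le_pole_iff hL, pole_le_iff hL] at h
    exact (tan_lt_tan_of_lt (mul_nonneg ha (hL e).le) (mul_lt_mul_of_pos_right hab (hL e))
      ((mul_le_mul_of_nonneg_right hb (hL e).le).trans (hk e)) h).le

section count

variable {E : Type*} [Fintype E] {L : E → ℝ} {k : ℝ}

theorem sum_tan_lt_sum_tan [Nonempty E] (hL : ∀ e, 0 < L e) (hk : ∀ e, k * L e ≤ Real.pi) {a b : ℝ}
    (ha : 0 ≤ a) (hab : a < b) (hb : b ≤ k)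
    (h : ∀ e, ¬ (a ≤ Real.pi / (2 * L e) ∧ Real.pi / (2 * L e) ≤ b)) :
    ∑ e, Real.tan (a * L e) < ∑ e, Real.tan (b * L e) := by
  refine Finset.sum_lt_sum_of_nonempty Finset.univ_nonempty fun e _ => ?_
  have h := h e
  rw [le_pole_iff hL, pole_le_iff hL] at h
  exact tan_lt_tan_of_lt (mul_nonneg ha (hL e).le) (mul_lt_mul_of_pos_right hab (hL e))
    ((mul_le_mul_of_nonneg_right hb (hL e).le).trans (hk e)) h

/-- Between two consecutive poles the sum of the tangents has a zero. -/
theorem exists_sum_tan_eq_zero (hL : ∀ e, 0 < L e) (hk : ∀ e, k * L e ≤ Real.pi)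
    {e₁ e₂ : E} (hlt : Real.pi / (2 * L e₁) < Real.pi / (2 * L e₂))
    (hle : Real.pi / (2 * L e₂) ≤ k)
    (hno : ∀ e, ¬ (Real.pi / (2 * L e₁) < Real.pi / (2 * L e) ∧
      Real.pi / (2 * L e) < Real.pi / (2 * L e₂))) :
    ∃ z, Real.pi / (2 * L e₁) < z ∧ z < Real.pi / (2 * L e₂) ∧ ∑ e, Real.tan (z * L e) = 0 := by
  classical
  have hπ := Real.pi_pos
  set q := Real.pi / (2 * L e₁) with hq
  set p := Real.pi / (2 * L e₂) with hp
  have hq0 : 0 < q := div_pos hπ (by linarith [hL e₁])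
  have hqL : q * L e₁ = Real.pi / 2 := by rw [hq]; have := (hL e₁).ne'; field_simp
  have hpL : p * L e₂ = Real.pi / 2 := by rw [hp]; have := (hL e₂).ne'; field_simp
  set m := (q + p) / 2 with hm
  have hqm : q < m := by rw [hm]; linarith
  have hmp : m < p := by rw [hm]; linarith
  have hright : ∃ x, m ≤ x ∧ x < p ∧ 0 < ∑ e, Real.tan (x * L e) := by
    -- The first entry puts `x` to the right of `m`. The second makes the tangent of `e₂` outweigh
    -- the other terms, which are at least their values at `m`.
    set c := max (Real.tan (m * L e₂)) (1 - ∑ e ∈ Finset.univ.erase e₂, Real.tan (m * L e)) with hc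
    set x := Real.arctan c / L e₂ with hx
    have hxL : x * L e₂ = Real.arctan c := by rw [hx]; have := (hL e₂).ne'; field_simp
    have hmx : m ≤ x := by
      rw [hx, le_div_iff₀ (hL e₂), ← Real.arctan_tan (x := m * L e₂)]
      · exact Real.arctan_strictMono.monotone (le_max_left _ _)
      · have := mul_pos (hq0.trans hqm) (hL e₂); linarith
      · rw [← hpL]; exact mul_lt_mul_of_pos_right hmp (hL e₂)
    have hxp : x < p := by
      rw [hx, div_lt_iff₀ (hL e₂), hpL]
      exact Real.arctan_lt_pi_div_two c
    refine ⟨x, hmx, hxp, ?_⟩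
    rw [← Finset.add_sum_erase _ _ (Finset.mem_univ e₂), hxL, Real.tan_arctan]
    have h1 : 1 - ∑ e ∈ Finset.univ.erase e₂, Real.tan (m * L e) ≤ c := le_max_right _ _
    have h2 : ∑ e ∈ Finset.univ.erase e₂, Real.tan (m * L e) ≤
        ∑ e ∈ Finset.univ.erase e₂, Real.tan (x * L e) :=
      Finset.sum_le_sum fun e _ => tan_mul_le_tan_mul hL hk (hq0.trans hqm).le hmx
        (hxp.le.trans hle) e fun h => hno e ⟨hqm.trans_le h.1, h.2.trans_lt hxp⟩
    linarith
  have hleft : ∃ x, q < x ∧ x ≤ m ∧ ∑ e, Real.tan (x * L e) < 0 := by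
    -- The mirror image, just after the pole of `e₁`; the shift by π below selects the branch of the
    -- tangent beyond π/2.
    set c := min (Real.tan (m * L e₁)) (-1 - ∑ e ∈ Finset.univ.erase e₁, Real.tan (m * L e)) with hc
    set x := (Real.arctan c + Real.pi) / L e₁ with hx
    have hxL : x * L e₁ = Real.arctan c + Real.pi := by
      rw [hx]; have := (hL e₁).ne'; field_simp
    have hxm : x ≤ m := by
      rw [hx, div_le_iff₀ (hL e₁), ← le_sub_iff_add_le, ← Real.arctan_tan (x := m * L e₁ - Real.pi)]
      · rw [Real.tan_sub_pi]
        exact Real.arctan_strictMono.monotone (min_le_left _ _)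
      · have := mul_lt_mul_of_pos_right hqm (hL e₁); linarith
      · have := mul_le_mul_of_nonneg_right (hmp.le.trans hle) (hL e₁).le
        linarith [hk e₁]
    have hqx : q < x := by
      rw [hx, lt_div_iff₀ (hL e₁), hqL]
      linarith [Real.neg_pi_div_two_lt_arctan c]
    refine ⟨x, hqx, hxm, ?_⟩
    rw [← Finset.add_sum_erase _ _ (Finset.mem_univ e₁), hxL, Real.tan_add_pi, Real.tan_arctan]
    have h1 : c ≤ -1 - ∑ e ∈ Finset.univ.erase e₁, Real.tan (m * L e) := min_le_right _ _
    have h2 : ∑ e ∈ Finset.univ.erase e₁, Real.tan (x * L e) ≤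
        ∑ e ∈ Finset.univ.erase e₁, Real.tan (m * L e) :=
      Finset.sum_le_sum fun e _ => tan_mul_le_tan_mul hL hk (hq0.trans hqx).le hxm
        (hmp.le.trans hle) e fun h => hno e ⟨hqx.trans_le h.1, h.2.trans_lt hmp⟩
    linarith
  obtain ⟨x₁, hx₁, hx₁m, hneg⟩ := hleft
  obtain ⟨x₂, hx₂m, hx₂, hpos⟩ := hright
  have hcont : ContinuousOn (fun x => ∑ e, Real.tan (x * L e)) (Icc x₁ x₂) := by
    refine continuousOn_finsetSum _ fun e _ x hx => ?_
    have hxk := hx.2.trans (hx₂.le.trans hle)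
    have hcos : Real.cos (x * L e) ≠ 0 := by
      intro h
      rw [cos_eq_zero_iff_of_mem (mul_nonneg (hq0.trans (hx₁.trans_le hx.1)).le (hL e).le)
        ((mul_le_mul_of_nonneg_right hxk (hL e).le).trans (hk e))] at h
      have : Real.pi / (2 * L e) = x :=
        le_antisymm ((pole_le_iff hL e x).2 h.ge) ((le_pole_iff hL e x).2 h.le)
      exact hno e ⟨this ▸ hx₁.trans_le hx.1, this ▸ hx.2.trans_lt hx₂⟩
    exact ((Real.continuousAt_tan.2 hcos).comp
      (f := fun x => x * L e) (by fun_prop)).continuousWithinAt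
  obtain ⟨z, hz, hz0⟩ := intermediate_value_Icc (hx₁m.trans hx₂m) hcont ⟨hneg.le, hpos.le⟩
  exact ⟨z, hx₁.trans_le hz.1, hz.2.trans_lt hx₂, hz0⟩

/-- Every pole is preceded by a zero of the sum of the tangents, with no pole in between. -/
theorem exists_zero_before_pole (hL : ∀ e, 0 < L e) (hk : ∀ e, k * L e ≤ Real.pi)
    {e₂ : E} (hle : Real.pi / (2 * L e₂) ≤ k) :
    ∃ z, 0 ≤ z ∧ z < Real.pi / (2 * L e₂) ∧ ∑ e, Real.tan (z * L e) = 0 ∧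
      ∀ e, ¬ (z ≤ Real.pi / (2 * L e) ∧ Real.pi / (2 * L e) < Real.pi / (2 * L e₂)) := by
  classical
  have hpos : ∀ e, 0 < Real.pi / (2 * L e) := fun e =>
    div_pos Real.pi_pos (by linarith [hL e])
  set S := Finset.univ.filter fun e => Real.pi / (2 * L e) < Real.pi / (2 * L e₂) with hS
  rcases S.eq_empty_or_nonempty with h | h
  -- Before the first pole the zero is μ = 0, the eigenvalue of the constants.
  · refine ⟨0, le_rfl, hpos e₂, by simp, fun e he => ?_⟩
    have : e ∈ S := by simpa [hS] using he.2
    simp [h] at this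
  · obtain ⟨e₁, he₁, hmax⟩ := S.exists_max_image (fun e => Real.pi / (2 * L e)) h
    have he₁' : Real.pi / (2 * L e₁) < Real.pi / (2 * L e₂) := by simpa [hS] using he₁
    have hmax' : ∀ e, Real.pi / (2 * L e) < Real.pi / (2 * L e₂) →
        Real.pi / (2 * L e) ≤ Real.pi / (2 * L e₁) := fun e he => hmax e (by simpa [hS] using he)
    obtain ⟨z, hz1, hz2, hz0⟩ := exists_sum_tan_eq_zero hL hk he₁' hle
      fun e he => (hmax' e he.2).not_gt he.1
    exact ⟨z, (hpos e₁).le.trans hz1.le, hz2, hz0,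
      fun e he => ((hmax' e he.2).trans_lt hz1).not_ge he.1⟩

open Classical in
-- Zeros in [0, k) are matched with distinct poles below k. A pole of m edges has dimension m - 1
-- and its zero has dimension 1, so the pair accounts for the m edges that share the pole.
theorem tsum_finrank_starCoeffs [Nonempty E] (hL : ∀ e, 0 < L e) (hk : ∀ e, k * L e ≤ Real.pi)
    (hcos : ∀ e, Real.cos (k * L e) ≠ 0) (hk0 : 0 < k) (hsum : ∑ e, Real.tan (k * L e) = 0) :
    ∑' μ : Ico 0 k, ((Module.finrank ℂ (starCoeffs L μ) : ℕ) : ℕ∞) =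
      ((Finset.univ.filter fun e => Real.pi / 2 < k * L e).card : ℕ∞) := by
  set pole : E → ℝ := fun e => Real.pi / (2 * L e) with hpole
  have hpos : ∀ e, 0 < pole e := fun e => div_pos Real.pi_pos (by linarith [hL e])
  set M := Finset.univ.filter fun e => Real.pi / 2 < k * L e with hM
  have hmemM : ∀ e, e ∈ M ↔ pole e < k := fun e => by
    rw [hM, Finset.mem_filter_univ, ← not_le, ← not_le, le_pole_iff hL]
  have hpole_ne : ∀ e, pole e ≠ k := fun e he => hcos e <| by
    rw [cos_eq_zero_iff_of_mem (mul_nonneg hk0.le (hL e).le) (hk e)]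
    exact le_antisymm ((le_pole_iff hL e k).1 he.ge) ((pole_le_iff hL e k).1 he.le)
  set P := M.image pole with hP
  have hex : ∀ p ∈ P, ∃ z, 0 ≤ z ∧ z < p ∧ ∑ e, Real.tan (z * L e) = 0 ∧
      ∀ e, ¬ (z ≤ pole e ∧ pole e < p) := by
    intro p hp
    obtain ⟨e, he, rfl⟩ := Finset.mem_image.1 hp
    exact exists_zero_before_pole hL hk ((hmemM e).1 he).le
  choose! z hz0 hzlt hzsum hzno using hex
  have hPk : ∀ p ∈ P, p < k := by
    intro p hp
    obtain ⟨e, he, rfl⟩ := Finset.mem_image.1 hp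
    exact (hmemM e).1 he
  set Z := P.image z with hZ
  have hcosz : ∀ μ ∈ Ico 0 k, ∀ e, Real.cos (μ * L e) = 0 ↔ pole e = μ := by
    intro μ hμ e
    rw [cos_eq_zero_iff_of_mem (mul_nonneg hμ.1 (hL e).le)
      ((mul_le_mul_of_nonneg_right hμ.2.le (hL e).le).trans (hk e)), le_antisymm_iff,
      ← le_pole_iff hL, ← pole_le_iff hL, and_comm, ← le_antisymm_iff]
  have hmemP : ∀ μ ∈ Ico 0 k, (μ ∈ P ↔ ∃ e, pole e = μ) := by
    intro μ hμ
    rw [hP, Finset.mem_image]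
    exact ⟨fun ⟨e, _, he⟩ => ⟨e, he⟩, fun ⟨e, he⟩ => ⟨e, (hmemM e).2 (he ▸ hμ.2), he⟩⟩
  have hZmem : ∀ μ ∈ Z, μ ∈ Ico 0 k ∧ μ ∉ P ∧ ∑ e, Real.tan (μ * L e) = 0 := by
    intro μ hμ
    obtain ⟨p, hp, rfl⟩ := Finset.mem_image.1 hμ
    have hI : z p ∈ Ico 0 k := ⟨hz0 p hp, (hzlt p hp).trans (hPk p hp)⟩
    refine ⟨hI, fun h => ?_, hzsum p hp⟩
    obtain ⟨e, he⟩ := (hmemP _ hI).1 h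
    exact hzno p hp e ⟨he.ge, he ▸ hzlt p hp⟩
  -- Some pole lies between a zero `μ` and `k`, since otherwise the sum would increase strictly from
  -- 0 at `μ` to 0 at `k`. By the same monotonicity `μ` is the zero chosen for the nearest such
  -- pole.
  have hmemZ : ∀ μ ∈ Ico 0 k, μ ∉ P → ∑ e, Real.tan (μ * L e) = 0 → μ ∈ Z := by
    intro μ hμ hμP hμ0
    have hne : (M.filter fun e => μ < pole e).Nonempty := by
      by_contra hempty
      rw [Finset.not_nonempty_iff_eq_empty, Finset.filter_eq_empty_iff] at hempty
      refine (sum_tan_lt_sum_tan hL hk hμ.1 hμ.2 le_rfl fun e he => ?_).ne (hμ0.trans hsum.symm)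
      refine hempty ((hmemM e).2 (lt_of_le_of_ne he.2 (hpole_ne e))) (lt_of_le_of_ne he.1 ?_)
      rintro h
      exact hμP ((hmemP μ hμ).2 ⟨e, h.symm⟩)
    obtain ⟨e, he, hmin⟩ := Finset.exists_min_image _ pole hne
    rw [Finset.mem_filter] at he
    have hp : pole e ∈ P := Finset.mem_image_of_mem _ he.1
    have hno : ∀ e', ¬ (μ ≤ pole e' ∧ pole e' < pole e) := by
      rintro e' ⟨h1, h2⟩
      rcases h1.eq_or_lt with h1 | h1
      · exact hμP ((hmemP μ hμ).2 ⟨e', h1.symm⟩)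
      · exact (hmin e' (Finset.mem_filter.2
          ⟨(hmemM e').2 (h2.trans ((hmemM e).1 he.1)), h1⟩)).not_gt h2
    refine Finset.mem_image.2 ⟨pole e, hp, ?_⟩
    rcases lt_trichotomy (z (pole e)) μ with h | h | h
    · exact absurd ((hzsum _ hp).trans hμ0.symm) (sum_tan_lt_sum_tan hL hk (hz0 _ hp) h hμ.2.le
        fun e' he' => hzno _ hp e' ⟨he'.1, he'.2.trans_lt he.2⟩).ne
    · exact h
    · exact absurd (hμ0.trans (hzsum _ hp).symm) (sum_tan_lt_sum_tan hL hk hμ.1 h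
        ((hzlt _ hp).le.trans (hPk _ hp).le)
        fun e' he' => hno e' ⟨he'.1, he'.2.trans_lt (hzlt _ hp)⟩).ne
  have hinj : InjOn z P := by
    intro p hp p' hp' h
    obtain ⟨e, -, he⟩ := Finset.mem_image.1 hp
    obtain ⟨e', -, he'⟩ := Finset.mem_image.1 hp'
    rcases lt_trichotomy p p' with hlt | hlt | hlt
    · exact absurd ⟨by rw [he, ← h]; exact (hzlt p hp).le, by rwa [he]⟩ (hzno p' hp' e)
    · exact hlt
    · exact absurd ⟨by rw [he', h]; exact (hzlt p' hp').le, by rwa [he']⟩ (hzno p hp e')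
  -- Away from the poles the filter is empty, and truncated subtraction makes the last term 0 - 1 =
  -- 0.
  have hdim : ∀ μ ∈ Ico 0 k, Module.finrank ℂ (starCoeffs L μ) =
      (if μ ∈ Z then 1 else 0) + ((M.filter fun e => pole e = μ).card - 1) := by
    intro μ hμ
    by_cases hμP : μ ∈ P
    · obtain ⟨e, he⟩ := (hmemP μ hμ).1 hμP
      rw [if_neg fun h => (hZmem μ h).2.1 hμP, zero_add]
      have h := finrank_starCoeffs_of_exists_cos_eq_zero (L := L) (μ := μ)
        (by rw [← he]; exact (hpos e).ne') ⟨e, (hcosz μ hμ e).2 he⟩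
      rw [Nat.card_eq_fintype_card, Fintype.card_subtype] at h
      have : (M.filter fun e => pole e = μ) = Finset.univ.filter fun e => Real.cos (μ * L e) = 0 := by
        ext e'
        simp only [Finset.mem_filter, hmemM, Finset.mem_univ, true_and, hcosz μ hμ]
        exact ⟨fun h => h.2, fun h => ⟨h ▸ hμ.2, h⟩⟩
      rw [this, ← h, Nat.add_sub_cancel]
    · have hne : ∀ e, pole e ≠ μ := fun e he => hμP ((hmemP μ hμ).2 ⟨e, he⟩)
      rw [finrank_starCoeffs_of_forall_cos_ne_zero fun e h => hne e ((hcosz μ hμ e).1 h),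
        Finset.filter_false_of_mem fun e _ => hne e, Finset.card_empty]
      have : (μ = 0 ∨ ∑ e, Real.tan (μ * L e) = 0) ↔ μ ∈ Z := by
        refine ⟨fun h => hmemZ μ hμ hμP ?_, fun h => Or.inr (hZmem μ h).2.2⟩
        rcases h with rfl | h
        · simp
        · exact h
      simp only [this]
      rfl
  have hPI : ∀ p ∈ P, p ∈ Ico 0 k := by
    intro p hp
    obtain ⟨e, he, rfl⟩ := Finset.mem_image.1 hp
    exact ⟨(hpos e).le, (hmemM e).1 he⟩
  have hT : ∀ μ ∈ Z ∪ P, μ ∈ Ico 0 k := by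
    intro μ hμ
    rcases Finset.mem_union.1 hμ with h | h
    · exact (hZmem μ h).1
    · exact hPI μ h
  have hfiber : ∀ μ ∉ P, (M.filter fun e => pole e = μ).card = 0 := by
    intro μ hμ
    rw [Finset.card_eq_zero, Finset.filter_eq_empty_iff]
    rintro e he rfl
    exact hμ (Finset.mem_image_of_mem _ he)
  have hzero : ∀ μ : Ico 0 k, μ ∉ (Z ∪ P).subtype (· ∈ Ico 0 k) →
      ((Module.finrank ℂ (starCoeffs L μ) : ℕ) : ℕ∞) = 0 := by
    intro μ hμ
    rw [Finset.mem_subtype, Finset.mem_union, not_or] at hμ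
    rw [hdim μ μ.2, if_neg hμ.1, hfiber _ hμ.2]
    rfl
  rw [tsum_eq_sum hzero,
    Finset.sum_subtype_of_mem (fun μ => ((Module.finrank ℂ (starCoeffs L μ) : ℕ) : ℕ∞)) hT,
    ← Nat.cast_sum]
  congr 1
  rw [Finset.sum_congr rfl fun μ hμ => hdim μ (hT μ hμ), Finset.sum_add_distrib,
    Finset.sum_ite_mem, Finset.union_inter_cancel_left, Finset.sum_const, smul_eq_mul, mul_one,
    hZ, Finset.card_image_of_injOn hinj,
    ← Finset.sum_subset Finset.subset_union_right fun μ _ hμ => by simp [hfiber μ hμ],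
    Finset.card_eq_sum_card_image pole M, Finset.card_eq_sum_ones, ← Finset.sum_add_distrib]
  refine Finset.sum_congr rfl fun p hp => ?_
  obtain ⟨e, he, hep⟩ := Finset.mem_image.1 hp
  have : 0 < (M.filter fun e => pole e = p).card :=
    Finset.card_pos.2 ⟨e, Finset.mem_filter.2 ⟨he, hep⟩⟩
  omega

end count

/-- Squaring, as a bijection from `[0, k)` to `[0, k ^ 2)`. -/
def sqEquiv {k : ℝ} (hk : 0 ≤ k) : Ico (0 : ℝ) k ≃ Ico (0 : ℝ) (k ^ 2) where
  toFun μ := ⟨(μ : ℝ) ^ 2, by positivity, pow_lt_pow_left₀ μ.2.2 μ.2.1 two_ne_zero⟩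
  invFun l := ⟨√l, Real.sqrt_nonneg _, (Real.sqrt_lt' (lt_of_le_of_ne hk (by
    rintro rfl
    have := l.2.1.trans_lt l.2.2
    simp at this))).2 l.2.2⟩
  left_inv μ := Subtype.ext (Real.sqrt_sq μ.2.1)
  right_inv l := Subtype.ext (Real.sq_sqrt l.2.1)

open Classical in
theorem IsStar.spectralPosition_eq {V E : Type*} {G : MetricGraph V E} {c : V} {τ : E → Bool}
    [Fintype E] [Nonempty E] (h : G.IsStar c τ) {k : ℝ} (hk0 : 0 < k)
    (hk : ∀ e, k * G.length e ≤ Real.pi) (hcos : ∀ e, Real.cos (k * G.length e) ≠ 0)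
    (hsum : ∑ e, Real.tan (k * G.length e) = 0) :
    G.spectralPosition k = ((Finset.univ.filter fun e => Real.pi / 2 < k * G.length e).card : ℕ) := by
  rw [spectralPosition, ← (sqEquiv hk0.le).tsum_eq,
    ← tsum_finrank_starCoeffs G.length_pos hk hcos hk0 hsum]
  exact tsum_congr fun μ => h.toENat_rank_eigenspace μ

/-! ### Angles whose tangents sum to zero. -/

section tan

/-- By induction from two angles, where tan x + tan S = sin(x + S) / (cos x cos S) and cos(x + S) ≤
cos x cos S. -/
theorem sum_tan_le_tan_sum {ι : Type*} (s : Finset ι) (θ : ι → ℝ) (h0 : ∀ i ∈ s, 0 ≤ θ i)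
    (h : ∑ i ∈ s, θ i < Real.pi / 2) :
    ∑ i ∈ s, Real.tan (θ i) ≤ Real.tan (∑ i ∈ s, θ i) := by
  classical
  induction s using Finset.induction_on with
  | empty => simp
  | insert a s ha ih =>
    rw [Finset.sum_insert ha] at h ⊢
    rw [Finset.sum_insert ha]
    have ha0 := h0 a (Finset.mem_insert_self _ _)
    have hs0 : ∀ i ∈ s, 0 ≤ θ i := fun i hi => h0 i (Finset.mem_insert_of_mem hi)
    have hS := Finset.sum_nonneg hs0
    have ih := ih hs0 (by linarith)
    set S := ∑ i ∈ s, θ i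
    set x := θ a
    have hπ := Real.pi_pos
    have hcx : 0 < Real.cos x := Real.cos_pos_of_mem_Ioo ⟨by linarith, by linarith⟩
    have hcS : 0 < Real.cos S := Real.cos_pos_of_mem_Ioo ⟨by linarith, by linarith⟩
    have hc : 0 < Real.cos (x + S) := Real.cos_pos_of_mem_Ioo ⟨by linarith, by linarith⟩
    have hsx : 0 ≤ Real.sin x := Real.sin_nonneg_of_nonneg_of_le_pi ha0 (by linarith)
    have hsS : 0 ≤ Real.sin S := Real.sin_nonneg_of_nonneg_of_le_pi hS (by linarith)
    have hsxS : 0 ≤ Real.sin (x + S) :=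
      Real.sin_nonneg_of_nonneg_of_le_pi (by linarith) (by linarith)
    have key : Real.tan x + Real.tan S ≤ Real.tan (x + S) := by
      have h1 : Real.tan x + Real.tan S = Real.sin (x + S) / (Real.cos x * Real.cos S) := by
        rw [Real.tan_eq_sin_div_cos, Real.tan_eq_sin_div_cos, Real.sin_add]
        field_simp
      rw [h1, Real.tan_eq_sin_div_cos]
      apply div_le_div_of_nonneg_left hsxS hc
      rw [Real.cos_add]
      nlinarith [mul_nonneg hsx hsS]
    linarith

open Classical in
-- The reflection θ ↦ π - θ exchanges the angles above and below π/2; the cosine condition excludes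
-- π/2 itself.
theorem card_filter_pi_div_two_lt_pi_sub {ι : Type*} [Fintype ι] {θ : ι → ℝ}
    (hcos : ∀ i, Real.cos (θ i) ≠ 0) :
    (Finset.univ.filter fun i => Real.pi / 2 < Real.pi - θ i).card +
      (Finset.univ.filter fun i => Real.pi / 2 < θ i).card = Fintype.card ι := by
  rw [add_comm, ← Finset.card_univ,
    ← Finset.card_filter_add_card_filter_not (s := Finset.univ) fun i => Real.pi / 2 < θ i]
  congr 2
  ext i
  simp only [Finset.mem_filter, Finset.mem_univ, true_and, not_lt]
  refine ⟨fun h => by linarith, fun h => ?_⟩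
  have := lt_of_le_of_ne h fun h => hcos i (h ▸ Real.cos_pi_div_two)
  linarith

variable {ι : Type*} [Fintype ι] [Nonempty ι] {θ : ι → ℝ}

theorem exists_pi_div_two_lt (h0 : ∀ i, 0 < θ i) (hsum : ∑ i, Real.tan (θ i) = 0)
    (hcos : ∀ i, Real.cos (θ i) ≠ 0) : ∃ i, Real.pi / 2 < θ i := by
  by_contra! h
  have : 0 < ∑ i, Real.tan (θ i) := Finset.sum_pos (fun i _ =>
    Real.tan_pos_of_pos_of_lt_pi_div_two (h0 i) (lt_of_le_of_ne (h i) fun hi =>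
      hcos i (hi ▸ Real.cos_pi_div_two))) Finset.univ_nonempty
  exact this.ne' hsum

open Classical in
-- Fix one large angle θ_j. The other large angles contribute more than π/2 each, so it suffices
-- that the small ones sum to at least π - θ_j. Otherwise superadditivity bounds the sum of their
-- tangents strictly below tan(π - θ_j) = -tan θ_j; as the other large angles have tangents ≤ 0, the
-- total would be negative.
theorem pi_div_two_mul_card_add_one_le (h0 : ∀ i, 0 < θ i) (hπ : ∀ i, θ i < Real.pi)
    (hcos : ∀ i, Real.cos (θ i) ≠ 0) (hsum : ∑ i, Real.tan (θ i) = 0) :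
    Real.pi / 2 * (((Finset.univ.filter fun i => Real.pi / 2 < θ i).card : ℝ) + 1) ≤ ∑ i, θ i := by
  set M := Finset.univ.filter fun i => Real.pi / 2 < θ i with hM
  have hmem : ∀ i, i ∈ M ↔ Real.pi / 2 < θ i := fun i => by simp [hM]
  have hmem' : ∀ i, i ∈ Mᶜ → θ i < Real.pi / 2 := fun i hi => by
    rw [Finset.mem_compl, hmem, not_lt] at hi
    exact lt_of_le_of_ne hi fun h => hcos i (h ▸ Real.cos_pi_div_two)
  rw [← Finset.sum_add_sum_compl M]
  obtain ⟨j, hj⟩ := exists_pi_div_two_lt h0 hsum hcos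
  have hj' := (hmem j).2 hj
  have hMsum : Real.pi / 2 * M.card + (θ j - Real.pi / 2) ≤ ∑ i ∈ M, θ i := by
    have : θ j - Real.pi / 2 ≤ ∑ i ∈ M, (θ i - Real.pi / 2) :=
      Finset.single_le_sum (f := fun i => θ i - Real.pi / 2)
        (fun i hi => by linarith [(hmem i).1 hi]) hj'
    rw [Finset.sum_sub_distrib, Finset.sum_const, nsmul_eq_mul] at this
    linarith
  suffices Real.pi - θ j ≤ ∑ i ∈ Mᶜ, θ i by linarith
  by_contra! hlt
  have hS : ∑ i ∈ Mᶜ, θ i < Real.pi / 2 := by linarith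
  have h1 := sum_tan_le_tan_sum Mᶜ θ (fun i _ => (h0 i).le) hS
  have h2 : Real.tan (∑ i ∈ Mᶜ, θ i) < Real.tan (Real.pi - θ j) :=
    Real.tan_lt_tan_of_lt_of_lt_pi_div_two
      (by linarith [Finset.sum_nonneg (s := Mᶜ) fun i _ => (h0 i).le, Real.pi_pos])
      (by linarith) hlt
  rw [Real.tan_pi_sub] at h2
  have h3 : ∑ i ∈ M, Real.tan (θ i) ≤ Real.tan (θ j) := by
    rw [← Finset.add_sum_erase _ _ hj']
    have : ∑ i ∈ M.erase j, Real.tan (θ i) ≤ 0 := Finset.sum_nonpos fun i hi => by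
      have hi := (hmem i).1 (Finset.mem_of_mem_erase hi)
      rw [← Real.tan_sub_pi]
      exact Real.tan_nonpos_of_nonpos_of_neg_pi_div_two_le (by linarith [hπ i]) (by linarith)
    linarith
  rw [← Finset.sum_add_sum_compl M] at hsum
  linarith

open Classical in
-- The lower bound applied to the reflected angles π - θ, whose tangents also sum to zero.
theorem sum_le_pi_div_two_mul (h0 : ∀ i, 0 < θ i) (hπ : ∀ i, θ i < Real.pi)
    (hcos : ∀ i, Real.cos (θ i) ≠ 0) (hsum : ∑ i, Real.tan (θ i) = 0) :
    ∑ i, θ i ≤ Real.pi / 2 *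
      (((Finset.univ.filter fun i => Real.pi / 2 < θ i).card : ℝ) + Fintype.card ι - 1) := by
  have h := pi_div_two_mul_card_add_one_le (θ := fun i => Real.pi - θ i)
    (fun i => sub_pos.2 (hπ i)) (fun i => by linarith [h0 i])
    (fun i => by rw [Real.cos_pi_sub]; exact neg_ne_zero.2 (hcos i))
    (by simp only [Real.tan_pi_sub, Finset.sum_neg_distrib, hsum, neg_zero])
  have hc := card_filter_pi_div_two_lt_pi_sub hcos
  have hc' := eq_sub_of_add_eq ((Nat.cast_add (R := ℝ) _ _).symm.trans (congrArg Nat.cast hc))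
  rw [Finset.sum_sub_distrib, Finset.sum_const, Finset.card_univ, nsmul_eq_mul, hc'] at h
  linarith

end tan

end MetricGraph

namespace MetricGraph
open Set MeasureTheory

variable {V E : Type*} {Γ : MetricGraph V E}

/-! ### Generic eigenfunctions are real waves up to a constant. -/

section reality

/-- The equation and the vertex conditions have real coefficients, so conjugation preserves them. -/
theorem star_mem_eigenspace {k : ℝ} (hk : k ≠ 0) {f : Γ.Point → ℂ}
    (hf : f ∈ Γ.eigenspace (k ^ 2)) : star f ∈ Γ.eigenspace (k ^ 2) := by
  have hf : Γ.SolvesEigenEquation (k ^ 2) f := hf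
  have hk' : (k : ℂ) ≠ 0 := by exact_mod_cast hk
  have hder : ∀ e, ∀ x ∈ Icc 0 (Γ.length e),
      Γ.edgeDeriv (star f) e x = star (Γ.edgeDeriv f e x) := fun e x hx =>
    (hf.hasDerivWithinAt e hx).star.derivWithin (uniqueDiffOn_Icc (Γ.length_pos e) x hx)
  refine ⟨fun e => ?_, fun v => ?_⟩
  · set α := Γ.onEdge f e 0 with hα
    set β := Γ.edgeDeriv f e 0 / k with hβ
    have h0 : (0 : ℝ) ∈ Icc 0 (Γ.length e) := left_mem_Icc.2 (Γ.length_pos e).le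
    refine edge_equation_of_hasDerivAt (U := fun x => star (α * (Real.cos (k * (x - 0)) : ℂ) +
        β * (Real.sin (k * (x - 0)) : ℂ)))
      (fun x => (((hasDerivAt_ofReal_cos k 0 x).const_mul α).add
        ((hasDerivAt_ofReal_sin k 0 x).const_mul β)).star) (fun x => ?_) fun x hx => ?_
    · have := ((((hasDerivAt_ofReal_sin k 0 x).const_mul (k : ℂ)).neg.const_mul α).add
        (((hasDerivAt_ofReal_cos k 0 x).const_mul (k : ℂ)).const_mul β)).star
      refine this.congr_deriv ?_
      simp
      ring
    · show star (Γ.onEdge f e x) = _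
      congr 1
      apply mul_left_cancel₀ hk'
      rw [(hf.edge_solution e hx h0).1, hβ]
      field_simp
      ring
  · have h := (hf.vertex_condition v).star
    rw [star_zero] at h
    convert h using 2 with p
    rw [outDeriv_eq, outDeriv_eq, hder _ _ (endCoord_mem _ _)]
    rcases p.1.2 <;> simp

theorem IsGenericEigenfunction.exists_star_eq {k : ℝ} (hk : k ≠ 0) {f : Γ.Point → ℂ}
    (hf : Γ.IsGenericEigenfunction (k ^ 2) f) : ∃ c : ℂ, star f = c • f := by
  have h1 : Module.finrank ℂ (Γ.eigenspace (k ^ 2)) = 1 :=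
    Module.rank_eq_one_iff_finrank_eq_one.1 hf.simple
  obtain ⟨c, hc⟩ := exists_smul_eq_of_finrank_eq_one h1
    (x := ⟨f, hf.eigenfunction.1⟩) (fun h => hf.eigenfunction.2 (congrArg Subtype.val h))
    ⟨star f, star_mem_eigenspace hk hf.eigenfunction.1⟩
  exact ⟨c, (congrArg Subtype.val hc).symm⟩

/-- Conjugation multiplies `f` and f' by the same constant, so f'(0)/f(0) is a real number t; the
denominator is a vertex value and hence nonzero. The phase is arctan(t/k)/k. -/
theorem IsGenericEigenfunction.exists_phase {k : ℝ} (hk : 0 < k) {f : Γ.Point → ℂ}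
    (hf : Γ.IsGenericEigenfunction (k ^ 2) f) (e : E) :
    ∃ A : ℂ, A ≠ 0 ∧ ∃ y : ℝ, ∀ x ∈ Icc 0 (Γ.length e),
      Γ.onEdge f e x = A * Real.cos (k * (x - y)) := by
  obtain ⟨c, hc⟩ := hf.exists_star_eq hk.ne'
  have hs : Γ.SolvesEigenEquation (k ^ 2) f := hf.eigenfunction.1
  have h0 : (0 : ℝ) ∈ Icc 0 (Γ.length e) := left_mem_Icc.2 (Γ.length_pos e).le
  set α := Γ.onEdge f e 0 with hα
  set p := Γ.edgeDeriv f e 0 with hp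
  have hα0 : α ≠ 0 := by
    rw [hα, onEdge, pt_zero]
    exact hf.ne_zero_at_vertices _
  have hstar : ∀ x, star (Γ.onEdge f e x) = c * Γ.onEdge f e x := fun x => congrFun hc (Γ.pt e x)
  have hpstar : star p = c * p := by
    have h1 := (hs.hasDerivWithinAt e h0).star
    have h2 := (hs.hasDerivWithinAt e h0).const_mul c
    simp only [hstar] at h1
    exact (uniqueDiffOn_Icc (Γ.length_pos e) 0 h0).eq_deriv _ h1 h2
  obtain ⟨t, ht⟩ : ∃ t : ℝ, p / α = (t : ℂ) := by
    rw [← Complex.conj_eq_iff_real, map_div₀]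
    have hc0 : c ≠ 0 := by
      rintro rfl
      have := hstar 0
      rw [zero_mul, star_eq_zero] at this
      exact hα0 this
    have h1 : (starRingEnd ℂ) p = c * p := hpstar
    have h2 : (starRingEnd ℂ) α = c * α := hstar 0
    rw [h1, h2, mul_div_mul_left _ _ hc0]
  have hk' : (k : ℂ) ≠ 0 := by exact_mod_cast hk.ne'
  set φ := Real.arctan (t / k) with hφ
  have hcφ : Real.cos φ ≠ 0 := (Real.cos_arctan_pos _).ne'
  have hcφ' : (Real.cos φ : ℂ) ≠ 0 := by exact_mod_cast hcφ
  have htan : Real.sin φ * k = t * Real.cos φ := by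
    have := Real.tan_arctan (t / k)
    rw [Real.tan_eq_sin_div_cos, div_eq_div_iff hcφ hk.ne'] at this
    exact this
  have htan' : (Real.sin φ : ℂ) * k = t * Real.cos φ := by exact_mod_cast htan
  refine ⟨α / Real.cos φ, div_ne_zero hα0 hcφ', φ / k, fun x hx => ?_⟩
  have hx := (hs.edge_solution e hx h0).1
  have harg : k * (x - φ / k) = k * x - φ := by field_simp
  apply mul_left_cancel₀ hk'
  rw [hx, harg, Real.cos_sub, sub_zero, ← hp, ← hα, show p = t * α by rw [← ht]; field_simp]
  generalize hC : (Real.cos φ : ℂ) = C at htan' hcφ'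
  push_cast at htan' ⊢
  rw [← Complex.ofReal_cos φ, hC]
  field_simp
  linear_combination (-Complex.sin (k * x)) * htan'

end reality

/-! ### The first Neumann point seen from an edge end. -/

/-- The coordinate on the edge `e` seen from its end `b`: the distance from that end. -/
def flip (Γ : MetricGraph V E) (e : E) : Bool → ℝ → ℝ
  | false, x => x
  | true, x => Γ.length e - x

@[simp] theorem flip_false (e : E) (x : ℝ) : Γ.flip e false x = x := rfl

@[simp] theorem flip_true (e : E) (x : ℝ) : Γ.flip e true x = Γ.length e - x := rfl

@[simp] theorem flip_flip (e : E) (b : Bool) (x : ℝ) : Γ.flip e b (Γ.flip e b x) = x := by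
  cases b <;> simp

@[simp] theorem flip_zero (e : E) (b : Bool) : Γ.flip e b 0 = Γ.endCoord e b := by
  cases b <;> simp [endCoord]

@[simp] theorem flip_endCoord (e : E) (b : Bool) : Γ.flip e b (Γ.endCoord e b) = 0 := by
  cases b <;> simp [endCoord]

theorem flip_endCoord_of_ne (e : E) {b b' : Bool} (h : b ≠ b') :
    Γ.flip e b (Γ.endCoord e b') = Γ.length e := by
  cases b <;> cases b' <;> simp_all [endCoord]

theorem continuous_flip (e : E) (b : Bool) : Continuous (Γ.flip e b) := by
  cases b
  · exact continuous_id
  · exact continuous_const.sub continuous_id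

theorem flip_mem_Icc {e : E} (b : Bool) {x : ℝ} (hx : x ∈ Icc 0 (Γ.length e)) :
    Γ.flip e b x ∈ Icc 0 (Γ.length e) := by
  cases b
  · exact hx
  · exact ⟨sub_nonneg.2 hx.2, sub_le_self _ hx.1⟩

theorem flip_mem_Ioo {e : E} (b : Bool) {x : ℝ} (hx : x ∈ Ioo 0 (Γ.length e)) :
    Γ.flip e b x ∈ Ioo 0 (Γ.length e) := by
  cases b
  · exact hx
  · exact ⟨sub_pos.2 hx.2, sub_lt_self _ hx.1⟩

/-- `f` is a cosine wave of frequency `k` along `e`, and its first extremum seen from the end `b` is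
at distance `r` from that end. -/
structure FirstExtremum (Γ : MetricGraph V E) (f : Γ.Point → ℂ) (k : ℝ) (e : E) (b : Bool)
    (r : ℝ) : Prop where
  pos : 0 < r
  le : k * r ≤ Real.pi
  lt_length : r < Γ.length e
  wave : ∃ A : ℂ, A ≠ 0 ∧ ∀ x ∈ Icc 0 (Γ.length e),
    Γ.onEdge f e x = A * Real.cos (k * (Γ.flip e b x - r))

/-- Shifting by π/k only changes the sign of the wave, so y may be reduced modulo π/k into (0, π/k].
This interval is closed on the right, so that an extremum at the end itself is replaced by the next
one. -/
theorem exists_wave_shift {k : ℝ} (hk : 0 < k) (y : ℝ) :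
    ∃ r, 0 < r ∧ k * r ≤ Real.pi ∧ ∃ ε : ℝ, ε ≠ 0 ∧
      ∀ s, Real.cos (k * (s - y)) = ε * Real.cos (k * (s - r)) := by
  have hw : 0 < Real.pi / k := div_pos Real.pi_pos hk
  have hmem := toIocMod_mem_Ioc hw 0 y
  rw [zero_add] at hmem
  refine ⟨toIocMod hw 0 y, hmem.1, ?_, (-1) ^ toIocDiv hw 0 y,
    zpow_ne_zero _ (by norm_num), fun s => ?_⟩
  · have := (le_div_iff₀ hk).1 hmem.2
    linarith
  · have hy := toIocMod_add_toIocDiv_zsmul hw 0 y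
    rw [zsmul_eq_mul] at hy
    have : k * (s - y) = k * (s - toIocMod hw 0 y) - toIocDiv hw 0 y * Real.pi := by
      conv_lhs => rw [← hy]
      field_simp
      ring
    rw [this, Real.cos_sub_int_mul_pi]

/-- The bound on the edge lengths enters here: kr ≤ π < k · length puts the extremum inside the
edge. -/
theorem IsGenericEigenfunction.exists_firstExtremum {k : ℝ} (hk : 0 < k) {f : Γ.Point → ℂ}
    (hf : Γ.IsGenericEigenfunction (k ^ 2) f) (hlen : ∀ e, Real.pi < k * Γ.length e)
    (e : E) (b : Bool) : ∃ r, Γ.FirstExtremum f k e b r := by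
  obtain ⟨A, hA, y, hy⟩ := hf.exists_phase hk e
  obtain ⟨r, hr0, hrk, ε, hε, hs⟩ := exists_wave_shift hk (Γ.flip e b y)
  refine ⟨r, hr0, hrk, lt_of_mul_lt_mul_left (hrk.trans_lt (hlen e)) hk.le, A * ε,
    mul_ne_zero hA (by exact_mod_cast hε), fun x hx => ?_⟩
  have : Real.cos (k * (x - y)) = Real.cos (k * (Γ.flip e b x - Γ.flip e b y)) := by
    cases b
    · rfl
    · rw [← Real.cos_neg]
      simp only [flip_true]
      ring_nf
  rw [hy x hx, this, hs]
  push_cast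
  ring

theorem pt_mem_neumannPoints_iff {f : Γ.Point → ℂ} {e : E} {x : ℝ} (hx : x ∈ Ioo 0 (Γ.length e)) :
    Γ.pt e x ∈ Γ.neumannPoints f ↔ Γ.edgeDeriv f e x = 0 := by
  rw [pt_of_mem_Ioo hx]
  constructor
  · rintro ⟨e', x', hx', h, h0⟩
    cases h
    exact h0
  · intro h
    exact ⟨e, x, hx, rfl, h⟩

theorem vertex_notMem_neumannPoints {f : Γ.Point → ℂ} (v : V) :
    Point.vertex v ∉ Γ.neumannPoints f := by
  rintro ⟨e, x, hx, h, -⟩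
  cases h

namespace FirstExtremum

variable {f : Γ.Point → ℂ} {k : ℝ} {e : E} {b : Bool} {r : ℝ}

theorem exists_edgeDeriv (h : Γ.FirstExtremum f k e b r) :
    ∃ A : ℂ, A ≠ 0 ∧ (∀ x ∈ Icc 0 (Γ.length e),
      Γ.onEdge f e x = A * Real.cos (k * (Γ.flip e b x - r))) ∧
      ∀ x ∈ Icc 0 (Γ.length e), Γ.edgeDeriv f e x =
        (if b then 1 else -1) * (k * A * Real.sin (k * (Γ.flip e b x - r))) := by
  obtain ⟨A, hA, hw⟩ := h.wave
  refine ⟨A, hA, hw, fun x hx => ?_⟩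
  cases b
  · rw [edgeDeriv_eq_of_eqOn (A := A) (μ := k) (y := r) hw hx]
    simp
  · have harg : ∀ x, k * (x - (Γ.length e - r)) = -(k * (Γ.flip e true x - r)) := fun x => by
      rw [flip_true]; ring
    rw [edgeDeriv_eq_of_eqOn (A := A) (μ := k) (y := Γ.length e - r) (fun x hx => by
      rw [hw x hx, harg, Real.cos_neg]) hx, harg, Real.sin_neg]
    simp

theorem mem_neumannPoints_iff (h : Γ.FirstExtremum f k e b r) (hk : 0 < k) {x : ℝ}
    (hx : x ∈ Ioo 0 (Γ.length e)) :
    Γ.pt e x ∈ Γ.neumannPoints f ↔ Real.sin (k * (Γ.flip e b x - r)) = 0 := by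
  obtain ⟨A, hA, -, hd⟩ := h.exists_edgeDeriv
  rw [pt_mem_neumannPoints_iff hx, hd x (Ioo_subset_Icc_self hx)]
  have hk' : (k : ℂ) ≠ 0 := by exact_mod_cast hk.ne'
  have hb : (if b then 1 else -1 : ℂ) ≠ 0 := by cases b <;> simp
  rw [mul_eq_zero_iff_left hb, mul_eq_zero_iff_left (mul_ne_zero hk' hA), Complex.ofReal_eq_zero]

theorem notMem_neumannPoints (h : Γ.FirstExtremum f k e b r) (hk : 0 < k) {x : ℝ}
    (hx : x ∈ Icc 0 (Γ.length e)) (hxr : Γ.flip e b x < r) : Γ.pt e x ∉ Γ.neumannPoints f := by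
  rcases eq_endCoord_or_mem_Ioo hx with hx' | ⟨b', rfl⟩
  · rw [h.mem_neumannPoints_iff hk hx']
    refine (Real.sin_neg_of_neg_of_neg_pi_lt (mul_neg_of_pos_of_neg hk (sub_neg.2 hxr)) ?_).ne
    have := mul_pos hk (flip_mem_Ioo b hx').1
    have := h.le
    linarith
  · rw [pt_endCoord]
    exact vertex_notMem_neumannPoints _

theorem mem_Ioo (h : Γ.FirstExtremum f k e b r) : Γ.flip e b r ∈ Ioo 0 (Γ.length e) :=
  flip_mem_Ioo b ⟨h.pos, h.lt_length⟩

theorem mem_neumannPoints (h : Γ.FirstExtremum f k e b r) (hk : 0 < k) :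
    Γ.pt e (Γ.flip e b r) ∈ Γ.neumannPoints f := by
  rw [h.mem_neumannPoints_iff hk h.mem_Ioo]
  simp

theorem exists_vertex_values (h : Γ.FirstExtremum f k e b r) :
    ∃ A : ℂ, A ≠ 0 ∧ f (Point.vertex (Γ.endpt e b)) = A * Real.cos (k * r) ∧
      Γ.outDeriv f e b = k * A * Real.sin (k * r) := by
  obtain ⟨A, hA, hw, hd⟩ := h.exists_edgeDeriv
  refine ⟨A, hA, ?_, ?_⟩
  · rw [← onEdge_endCoord f e b, hw _ (endCoord_mem e b), flip_endCoord, zero_sub, mul_neg,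
      Real.cos_neg]
  · rw [outDeriv_eq, hd _ (endCoord_mem e b), flip_endCoord, zero_sub, mul_neg, Real.sin_neg]
    cases b <;> simp

theorem cos_ne_zero (h : Γ.FirstExtremum f k e b r)
    (hf : f (Point.vertex (Γ.endpt e b)) ≠ 0) : Real.cos (k * r) ≠ 0 := by
  obtain ⟨A, -, hv, -⟩ := h.exists_vertex_values
  intro h0
  rw [hv, h0] at hf
  simp at hf

/-- The quotient of kA sin(kr) by A cos(kr); it turns the Kirchhoff condition into a condition on
tangents. -/
theorem outDeriv_eq_mul_tan (h : Γ.FirstExtremum f k e b r)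
    (hf : f (Point.vertex (Γ.endpt e b)) ≠ 0) :
    Γ.outDeriv f e b = k * f (Point.vertex (Γ.endpt e b)) * Real.tan (k * r) := by
  have hc := h.cos_ne_zero hf
  have hc' : (Real.cos (k * r) : ℂ) ≠ 0 := by exact_mod_cast hc
  obtain ⟨A, hA, hv, ho⟩ := h.exists_vertex_values
  rw [hv, ho, Real.tan_eq_sin_div_cos, Complex.ofReal_div]
  field_simp

/-- If kr = π, the end of the edge would be an extremum as well. -/
theorem lt_pi (h : Γ.FirstExtremum f k e b r) (ho : Γ.outDeriv f e b ≠ 0) :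
    k * r < Real.pi := by
  obtain ⟨A, -, -, ho'⟩ := h.exists_vertex_values
  refine lt_of_le_of_ne h.le fun h0 => ho ?_
  rw [ho', h0, Real.sin_pi]
  simp

end FirstExtremum

/-! ### The topology of stars and segments in a metric graph. -/

section topology

theorem isOpen_iff {S : Set Γ.Point} :
    IsOpen S ↔ ∀ e, IsOpen {x : Icc (0 : ℝ) (Γ.length e) | Γ.pt e x ∈ S} := by
  rw [isOpen_coinduced, isOpen_sigma_iff]
  rfl

theorem isClosed_iff {S : Set Γ.Point} :
    IsClosed S ↔ ∀ e, IsClosed {x : Icc (0 : ℝ) (Γ.length e) | Γ.pt e x ∈ S} := by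
  rw [isClosed_coinduced, isClosed_sigma_iff]
  rfl

theorem continuousOn_pt (e : E) : ContinuousOn (Γ.pt e) (Icc 0 (Γ.length e)) := by
  rw [continuousOn_iff_continuous_domRestrict]
  have h : Continuous fun p : (Σ e : E, Icc (0 : ℝ) (Γ.length e)) => Γ.pt p.1 p.2 :=
    continuous_coinduced_rng
  exact h.comp (continuous_sigmaMk (σ := fun e : E => Icc (0 : ℝ) (Γ.length e)) (i := e))

/-- An isolated vertex would be a clopen point, hence the whole graph, although there is an edge. -/
theorem exists_endpt_eq [ConnectedSpace Γ.Point] [Nonempty E] (v : V) :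
    ∃ e b, Γ.endpt e b = v := by
  by_contra! h
  have hpre : ∀ e (x : Icc (0 : ℝ) (Γ.length e)), Γ.pt e x ≠ Point.vertex v := by
    intro e x hx
    obtain ⟨b, -, hb⟩ := (pt_eq_vertex_iff x.2 v).1 hx
    exact h e b hb
  have hcl : IsClopen ({Point.vertex v} : Set Γ.Point) := by
    constructor
    · rw [isClosed_iff]
      intro e
      simp [hpre]
    · rw [isOpen_iff]
      intro e
      simp [hpre]
  rcases isClopen_iff.1 hcl with h0 | h0
  · exact (singleton_nonempty _).ne_empty h0
  · obtain ⟨e⟩ := ‹Nonempty E›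
    have hmem : Γ.pt e 0 ∈ ({Point.vertex v} : Set Γ.Point) := by
      rw [h0]; exact mem_univ _
    exact hpre e ⟨0, left_mem_Icc.2 (Γ.length_pos e).le⟩ hmem

/-- The closed set `T` witnesses that `S` is closed relative to `U`, so `S` is a connected and
relatively clopen subset of `U`. -/
theorem connectedComponentIn_eq_of_isOpen_of_isClosed {X : Type*} [TopologicalSpace X]
    {U S T : Set X} (hSU : S ⊆ U) (hS : IsOpen S) (hST : S ⊆ T) (hT : IsClosed T) (hTU : T ∩ U ⊆ S)
    (hconn : IsPreconnected S) {q : X} (hq : q ∈ S) : connectedComponentIn U q = S := by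
  apply Subset.antisymm
  · refine isPreconnected_connectedComponentIn.subset_left_of_subset_union hS hT.isOpen_compl
      (disjoint_compl_right.mono_left hST) (fun x hx => ?_)
      ⟨q, mem_connectedComponentIn (hSU hq), hq⟩
    by_cases hxT : x ∈ T
    · exact Or.inl (hTU ⟨hxT, connectedComponentIn_subset _ _ hx⟩)
    · exact Or.inr hxT
  · exact hconn.subset_connectedComponentIn hq hSU

/-- The vertex `v` and the points on the edges at `v` whose distance `t` from an end at `v` satisfies
`R t r`, with `r` a given radius for each edge end. -/
def starSet (Γ : MetricGraph V E) (R : ℝ → ℝ → Prop) (r : E → Bool → ℝ) (v : V) : Set Γ.Point :=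
  {q | match q with
    | Point.vertex w => w = v
    | Point.inner e x _ => ∃ b, Γ.endpt e b = v ∧ R (Γ.flip e b x) (r e b)}

/-- The two conditions on `R` make the radius test agree with the test on vertices at both ends of
an edge, so one criterion covers the closed edge. -/
theorem pt_mem_starSet_iff {R : ℝ → ℝ → Prop} {r : E → Bool → ℝ} (h0 : ∀ e b, R 0 (r e b))
    (h1 : ∀ e b, ¬ R (Γ.length e) (r e b)) {v : V} {e : E} {x : ℝ}
    (hx : x ∈ Icc 0 (Γ.length e)) :
    Γ.pt e x ∈ Γ.starSet R r v ↔ ∃ b, Γ.endpt e b = v ∧ R (Γ.flip e b x) (r e b) := by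
  rcases eq_endCoord_or_mem_Ioo hx with hx' | ⟨b', rfl⟩
  · rw [pt_of_mem_Ioo hx']
    rfl
  · rw [pt_endCoord]
    constructor
    · intro h
      exact ⟨b', h, by rw [flip_endCoord]; exact h0 e b'⟩
    · rintro ⟨b, rfl, hb⟩
      by_cases hbb : b = b'
      · subst hbb; rfl
      · rw [flip_endCoord_of_ne e hbb] at hb
        exact absurd hb (h1 e b)

variable {r : E → Bool → ℝ}

theorem isOpen_starSet (h0 : ∀ e b, 0 < r e b) (h1 : ∀ e b, r e b < Γ.length e) (v : V) :
    IsOpen (Γ.starSet (· < ·) r v) := by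
  rw [isOpen_iff]
  intro e
  have : {x : Icc (0 : ℝ) (Γ.length e) | Γ.pt e x ∈ Γ.starSet (· < ·) r v} =
      ⋃ b, ⋃ _ : Γ.endpt e b = v, {x : Icc (0 : ℝ) (Γ.length e) | Γ.flip e b x < r e b} := by
    ext x
    simp only [mem_ofPred_eq, pt_mem_starSet_iff h0 (fun e b => (h1 e b).not_gt) x.2, mem_iUnion,
      exists_prop]
  rw [this]
  exact isOpen_iUnion fun b => isOpen_iUnion fun _ =>
    isOpen_lt ((continuous_flip e b).comp continuous_subtype_val) continuous_const

theorem isClosed_starSet (h0 : ∀ e b, 0 < r e b) (h1 : ∀ e b, r e b < Γ.length e) (v : V) :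
    IsClosed (Γ.starSet (· ≤ ·) r v) := by
  rw [isClosed_iff]
  intro e
  have : {x : Icc (0 : ℝ) (Γ.length e) | Γ.pt e x ∈ Γ.starSet (· ≤ ·) r v} =
      ⋃ b, ⋃ _ : Γ.endpt e b = v, {x : Icc (0 : ℝ) (Γ.length e) | Γ.flip e b x ≤ r e b} := by
    ext x
    simp only [mem_ofPred_eq, pt_mem_starSet_iff (fun e b => (h0 e b).le)
      (fun e b => (h1 e b).not_ge) x.2, mem_iUnion, exists_prop]
  rw [this]
  exact isClosed_iUnion_of_finite fun b => isClosed_iUnion_of_finite fun _ =>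
    isClosed_le ((continuous_flip e b).comp continuous_subtype_val) continuous_const

theorem isPreconnected_starSet (h0 : ∀ e b, 0 < r e b) (h1 : ∀ e b, r e b < Γ.length e) (v : V) :
    IsPreconnected (Γ.starSet (· < ·) r v) := by
  refine isPreconnected_of_forall (Point.vertex v) fun q hq => ?_
  cases q with
  | vertex w =>
    obtain rfl : w = v := hq
    exact ⟨{Point.vertex w}, by rw [singleton_subset_iff]; exact rfl, rfl, rfl,
      isPreconnected_singleton⟩
  | inner e x hx =>
    obtain ⟨b, rfl, hb⟩ := hq
    have hmem : ∀ t ∈ Ico 0 (r e b), Γ.flip e b t ∈ Icc 0 (Γ.length e) := fun t ht =>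
      flip_mem_Icc b ⟨ht.1, (ht.2.trans (h1 e b)).le⟩
    refine ⟨(fun t => Γ.pt e (Γ.flip e b t)) '' Ico 0 (r e b), ?_, ⟨0, ⟨le_rfl, h0 e b⟩, ?_⟩,
      ⟨Γ.flip e b x, ⟨(flip_mem_Ioo b hx).1.le, hb⟩, ?_⟩, ?_⟩
    · rintro _ ⟨t, ht, rfl⟩
      rw [pt_mem_starSet_iff h0 (fun e b => (h1 e b).not_gt) (hmem t ht)]
      exact ⟨b, rfl, by rw [flip_flip]; exact ht.2⟩
    · simp only [flip_zero, pt_endCoord]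
    · simp only [flip_flip, pt_of_mem_Ioo hx]
    · exact isPreconnected_Ico.image _
        ((continuousOn_pt e).comp (continuous_flip e b).continuousOn hmem)

/-- The points of the edge `e` with coordinate strictly between `a` and `b`. -/
def openSegment (Γ : MetricGraph V E) (e : E) (a b : ℝ) : Set Γ.Point := Γ.pt e '' Ioo a b

theorem pt_eq_pt_of_mem_Ioo {e e' : E} {x x' : ℝ} (hx : x ∈ Ioo 0 (Γ.length e))
    (hx' : x' ∈ Icc 0 (Γ.length e')) (h : Γ.pt e x = Γ.pt e' x') : e' = e ∧ x' = x := by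
  rw [pt_of_mem_Ioo hx] at h
  rcases eq_endCoord_or_mem_Ioo hx' with hx' | ⟨b, rfl⟩
  · rw [pt_of_mem_Ioo hx'] at h
    cases h
    exact ⟨rfl, rfl⟩
  · rw [pt_endCoord] at h
    cases h

theorem isOpen_openSegment (e : E) {a b : ℝ} (ha : 0 ≤ a) (hb : b ≤ Γ.length e) :
    IsOpen (Γ.openSegment e a b) := by
  rw [isOpen_iff]
  intro e'
  by_cases he : e' = e
  · subst he
    have : {x : Icc (0 : ℝ) (Γ.length e') | Γ.pt e' x ∈ Γ.openSegment e' a b} =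
        Subtype.val ⁻¹' Ioo a b := by
      ext x
      constructor
      · rintro ⟨y, hy, hyx⟩
        obtain ⟨-, hxy⟩ := pt_eq_pt_of_mem_Ioo ⟨ha.trans_lt hy.1, hy.2.trans_le hb⟩ x.2 hyx
        rwa [mem_preimage, hxy]
      · intro hx
        exact ⟨x, hx, rfl⟩
    rw [this]
    exact isOpen_Ioo.preimage continuous_subtype_val
  · convert isOpen_empty
    rw [eq_empty_iff_forall_notMem]
    rintro x ⟨y, hy, hyx⟩
    exact he (pt_eq_pt_of_mem_Ioo ⟨ha.trans_lt hy.1, hy.2.trans_le hb⟩ x.2 hyx).1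

theorem isClosed_image_pt (e : E) {a b : ℝ} (ha : 0 < a) (hb : b < Γ.length e) :
    IsClosed (Γ.pt e '' Icc a b) := by
  rw [isClosed_iff]
  intro e'
  by_cases he : e' = e
  · subst he
    have : {x : Icc (0 : ℝ) (Γ.length e') | Γ.pt e' x ∈ Γ.pt e' '' Icc a b} =
        Subtype.val ⁻¹' Icc a b := by
      ext x
      constructor
      · rintro ⟨y, hy, hyx⟩
        obtain ⟨-, hxy⟩ := pt_eq_pt_of_mem_Ioo ⟨ha.trans_le hy.1, hy.2.trans_lt hb⟩ x.2 hyx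
        rwa [mem_preimage, hxy]
      · intro hx
        exact ⟨x, hx, rfl⟩
    rw [this]
    exact isClosed_Icc.preimage continuous_subtype_val
  · convert isClosed_empty
    rw [eq_empty_iff_forall_notMem]
    rintro x ⟨y, hy, hyx⟩
    exact he (pt_eq_pt_of_mem_Ioo ⟨ha.trans_le hy.1, hy.2.trans_lt hb⟩ x.2 hyx).1

theorem isPreconnected_openSegment (e : E) {a b : ℝ} (ha : 0 ≤ a) (hb : b ≤ Γ.length e) :
    IsPreconnected (Γ.openSegment e a b) :=
  isPreconnected_Ioo.image _ ((continuousOn_pt e).mono fun _ hx =>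
    ⟨ha.trans hx.1.le, hx.2.le.trans hb⟩)

end topology

/-! ### The shape of a Neumann domain. -/

/-- A Neumann domain is the star around a vertex up to the first Neumann points, or an open segment
of length `π / k` between two Neumann points. -/
theorem IsNeumannDomain.eq_starSet_or_openSegment {f : Γ.Point → ℂ} {k : ℝ} (hk : 0 < k)
    {r : E → Bool → ℝ} (hr : ∀ e b, Γ.FirstExtremum f k e b (r e b)) {C : Set Γ.Point}
    (hC : Γ.IsNeumannDomain f C) :
    (∃ v, C = Γ.starSet (· < ·) r v) ∨ ∃ e a b, k * (b - a) = Real.pi ∧ 0 < a ∧ b < Γ.length e ∧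
      Γ.pt e a ∈ Γ.neumannPoints f ∧ Γ.pt e b ∈ Γ.neumannPoints f ∧ C = Γ.openSegment e a b := by
  obtain ⟨q, hq, rfl⟩ := hC
  have h0 : ∀ e b, 0 < r e b := fun e b => (hr e b).pos
  have h1 : ∀ e b, r e b < Γ.length e := fun e b => (hr e b).lt_length
  have hstar : ∀ v, q ∈ Γ.starSet (· < ·) r v →
      connectedComponentIn (Γ.neumannPoints f)ᶜ q = Γ.starSet (· < ·) r v := by
    intro v hv
    -- The closed star adds only the points at distance exactly `r`, and these are Neumann points.
    refine connectedComponentIn_eq_of_isOpen_of_isClosed ?_ (isOpen_starSet h0 h1 v) ?_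
      (isClosed_starSet h0 h1 v) ?_ (isPreconnected_starSet h0 h1 v) hv
    · intro q hq
      cases q with
      | vertex w => exact vertex_notMem_neumannPoints w
      | inner e x hx =>
        obtain ⟨b, -, hb⟩ := hq
        have := (hr e b).notMem_neumannPoints hk (Ioo_subset_Icc_self hx) hb
        rwa [pt_of_mem_Ioo hx] at this
    · intro q hq
      cases q with
      | vertex w => exact hq
      | inner e x hx =>
        obtain ⟨b, hb, hb'⟩ := hq
        exact ⟨b, hb, hb'.le⟩
    · rintro q ⟨hq, hqU⟩
      cases q with
      | vertex w => exact hq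
      | inner e x hx =>
        obtain ⟨b, hb, hb'⟩ := hq
        refine ⟨b, hb, lt_of_le_of_ne hb' fun h => hqU ?_⟩
        have := (hr e b).mem_neumannPoints hk
        rwa [← h, flip_flip, pt_of_mem_Ioo hx] at this
  cases q with
  | vertex v => exact Or.inl ⟨v, hstar v rfl⟩
  | inner e x hx =>
    by_cases hex : ∃ b, Γ.flip e b x < r e b
    · obtain ⟨b, hb⟩ := hex
      exact Or.inl ⟨Γ.endpt e b, hstar _ ⟨b, rfl, hb⟩⟩
    right
    push Not at hex
    rw [mem_compl_iff, ← pt_of_mem_Ioo hx] at hq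
    set y := r e false with hy
    have hmem : ∀ z ∈ Ioo 0 (Γ.length e),
        (Γ.pt e z ∈ Γ.neumannPoints f ↔ ∃ n : ℤ, n * Real.pi = k * (z - y)) := fun z hz => by
      rw [(hr e false).mem_neumannPoints_iff hk hz, Real.sin_eq_zero_iff]
      rfl
    have hyx : y ≤ x := hex false
    have hπ := Real.pi_pos
    -- The Neumann points of the edge lie at y + mπ/k with m an integer, so `n` and `n + 1` give the
    -- two that surround `x`.
    set n := ⌊k * (x - y) / Real.pi⌋ with hn
    have hn0 : 0 ≤ n := Int.floor_nonneg.2 (div_nonneg (mul_nonneg hk.le (sub_nonneg.2 hyx)) hπ.le)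
    have hn1 : n * Real.pi ≤ k * (x - y) := (le_div_iff₀ hπ).1 (Int.floor_le _)
    have hn2 : k * (x - y) < (n + 1) * Real.pi := (div_lt_iff₀ hπ).1 (Int.lt_floor_add_one _)
    have hn1' : n * Real.pi < k * (x - y) :=
      lt_of_le_of_ne hn1 fun h => hq ((hmem x hx).2 ⟨n, h⟩)
    set a := y + n * Real.pi / k with ha
    set b := y + (n + 1) * Real.pi / k with hb
    have hka : k * (a - y) = n * Real.pi := by rw [ha]; field_simp; ring
    have hkb : k * (b - y) = (n + 1) * Real.pi := by rw [hb]; field_simp; ring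
    have hax : a < x := by
      have : k * (a - y) < k * (x - y) := hka ▸ hn1'
      linarith [lt_of_mul_lt_mul_left this hk.le]
    have hxb : x < b := by
      have : k * (x - y) < k * (b - y) := hkb ▸ hn2
      linarith [lt_of_mul_lt_mul_left this hk.le]
    have hn0' : (0 : ℝ) ≤ n := by exact_mod_cast hn0
    have hya : y ≤ a := by
      have : k * 0 ≤ k * (a - y) := by rw [hka, mul_zero]; positivity
      linarith [le_of_mul_le_mul_left this hk]
    have ha0 : 0 < a := (h0 e false).trans_le hya
    have hbl : b < Γ.length e := by
      obtain ⟨m, hm⟩ := (hmem _ (hr e true).mem_Ioo).1 ((hr e true).mem_neumannPoints hk)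
      have hxr : x ≤ Γ.flip e true (r e true) := by
        have := hex true
        rw [flip_true] at this ⊢
        linarith
      have hnm : n < m := by
        have h2 := mul_le_mul_of_nonneg_left (sub_le_sub_right hxr y) hk.le
        rw [← hm] at h2
        exact_mod_cast lt_of_mul_lt_mul_right (hn1'.trans_le h2) hπ.le
      have hnm' : (n + 1 : ℝ) ≤ m := by exact_mod_cast hnm
      have h3 := mul_le_mul_of_nonneg_right hnm' hπ.le
      rw [← hkb, hm] at h3
      linarith [le_of_mul_le_mul_left h3 hk, (hr e true).mem_Ioo.2]
    have hpa : Γ.pt e a ∈ Γ.neumannPoints f :=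
      (hmem a ⟨ha0, hax.trans hx.2⟩).2 ⟨n, hka.symm⟩
    have hpb : Γ.pt e b ∈ Γ.neumannPoints f :=
      (hmem b ⟨hx.1.trans hxb, hbl⟩).2 ⟨n + 1, by push_cast; exact hkb.symm⟩
    refine ⟨e, a, b, by linear_combination hkb - hka, ha0, hbl, hpa, hpb, ?_⟩
    refine connectedComponentIn_eq_of_isOpen_of_isClosed (T := Γ.pt e '' Icc a b) ?_
      (isOpen_openSegment e ha0.le hbl.le) (image_mono Ioo_subset_Icc_self)
      (isClosed_image_pt e ha0 hbl) ?_ (isPreconnected_openSegment e ha0.le hbl.le)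
      ⟨x, ⟨hax, hxb⟩, pt_of_mem_Ioo hx⟩
    · rintro _ ⟨z, hz, rfl⟩ hzN
      obtain ⟨m, hm⟩ := (hmem z ⟨ha0.trans hz.1, hz.2.trans hbl⟩).1 hzN
      have h1 := mul_lt_mul_of_pos_left (sub_lt_sub_right hz.1 y) hk
      have h2 := mul_lt_mul_of_pos_left (sub_lt_sub_right hz.2 y) hk
      rw [hka, ← hm] at h1
      rw [hkb, ← hm] at h2
      have h1 : n < m := by exact_mod_cast lt_of_mul_lt_mul_right h1 hπ.le
      have h2 : m < n + 1 := by exact_mod_cast lt_of_mul_lt_mul_right h2 hπ.le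
      omega
    · rintro _ ⟨⟨z, hz, rfl⟩, hzU⟩
      refine ⟨z, ⟨lt_of_le_of_ne hz.1 ?_, lt_of_le_of_ne hz.2 ?_⟩, rfl⟩
      · rintro rfl; exact hzU hpa
      · rintro rfl; exact hzU hpb

end MetricGraph

/-! ### Neumann domains as star graphs. -/

namespace MetricGraph
open Set MeasureTheory

variable {V E : Type*} {Γ : MetricGraph V E} {f : Γ.Point → ℂ} {C : Set Γ.Point}

namespace Segment

theorem eq_of_coords {s s' : Γ.Segment f C} (he : s.edge = s'.edge) (ha : s.a = s'.a)
    (hb : s.b = s'.b) : s = s' := by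
  cases s
  cases s'
  subst he ha hb
  rfl

theorem mem_Ioo_length (s : Γ.Segment f C) {x : ℝ} (hx : x ∈ Ioo s.a s.b) :
    x ∈ Ioo 0 (Γ.length s.edge) :=
  ⟨s.isCut_a.1.1.trans_lt hx.1, hx.2.trans_le s.isCut_b.1.2⟩

theorem not_isCut (hC : C ⊆ (Γ.neumannPoints f)ᶜ) (s : Γ.Segment f C) {x : ℝ}
    (hx : x ∈ Ioo s.a s.b) : ¬ Γ.IsCut f s.edge x := by
  have hx' := s.mem_Ioo_length hx
  rintro ⟨-, h | h | h⟩
  · exact hx'.1.ne' h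
  · exact hx'.2.ne h
  · exact hC (s.subset x hx) h

/-- Two segments of a Neumann domain with a common inner point are equal. -/
theorem eq_of_mem (hC : C ⊆ (Γ.neumannPoints f)ᶜ) {s s' : Γ.Segment f C}
    (he : s.edge = s'.edge) {x : ℝ} (hx : x ∈ Ioo s.a s.b) (hx' : x ∈ Ioo s'.a s'.b) : s = s' := by
  refine eq_of_coords he ?_ ?_
  · rcases lt_trichotomy s.a s'.a with h | h | h
    · exact absurd (he ▸ s'.isCut_a) (s.not_isCut hC ⟨h, hx'.1.trans hx.2⟩)
    · exact h
    · exact absurd (he ▸ s.isCut_a) (s'.not_isCut hC ⟨h, hx.1.trans hx'.2⟩)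
  · rcases lt_trichotomy s.b s'.b with h | h | h
    · exact absurd (he ▸ s.isCut_b) (s'.not_isCut hC ⟨hx'.1.trans hx.2, h⟩)
    · exact h
    · exact absurd (he ▸ s'.isCut_b) (s.not_isCut hC ⟨hx.1.trans hx'.2, h⟩)

theorem endVertex_eq_inl {s : Γ.Segment f C} {i : Bool} {v : V}
    (h : Γ.pt s.edge (s.coord i) = Point.vertex v) : s.endVertex i = Sum.inl v := by
  simp only [endVertex, h]

theorem endVertex_eq_inr {s : Γ.Segment f C} {i : Bool}
    (h : s.coord i ∈ Ioo 0 (Γ.length s.edge)) : s.endVertex i = Sum.inr (s, i) := by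
  simp only [endVertex, pt_of_mem_Ioo h]

end Segment

theorem IsNeumannDomain.subset (hC : Γ.IsNeumannDomain f C) : C ⊆ (Γ.neumannPoints f)ᶜ := by
  obtain ⟨q, -, rfl⟩ := hC
  exact connectedComponentIn_subset _ _

theorem isCut_endCoord (e : E) (b : Bool) : Γ.IsCut f e (Γ.endCoord e b) := by
  refine ⟨endCoord_mem e b, ?_⟩
  cases b
  · exact Or.inl rfl
  · exact Or.inr (Or.inl rfl)

/-- The properties of a Neumann domain, as a star graph, from which its spectral position is
computed. -/
structure IsNeumannStar {V E : Type*} [Fintype E] (G : MetricGraph V E) (k : ℝ) : Prop where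
  isStar : ∃ c τ, G.IsStar c τ
  nonempty : Nonempty E
  length_le : ∀ e, k * G.length e ≤ Real.pi
  cos_ne_zero : ∀ e, Real.cos (k * G.length e) ≠ 0
  sum_tan : ∑ e, Real.tan (k * G.length e) = 0
  length_lt : Fintype.card E = 1 ∨ ∀ e, k * G.length e < Real.pi

section openSegment

/-- The segment is a star with one arm, the vertex at its left end serving as center. Its angle is
π, with tangent 0 and cosine -1. -/
theorem exists_isNeumannStar_openSegment {k : ℝ} {e : E} {a b : ℝ} (hk : 0 < k)
    (hab : k * (b - a) = Real.pi) (ha : 0 < a) (hb : b < Γ.length e)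
    (hpa : Γ.pt e a ∈ Γ.neumannPoints f) (hpb : Γ.pt e b ∈ Γ.neumannPoints f)
    (hC : Γ.openSegment e a b ⊆ (Γ.neumannPoints f)ᶜ) :
    ∃ _ : Fintype (Γ.Segment f (Γ.openSegment e a b)),
      (Γ.neumannDomainGraph f (Γ.openSegment e a b)).IsNeumannStar k := by
  have hlt : a < b := by
    have : 0 < k * (b - a) := hab ▸ Real.pi_pos
    exact sub_pos.1 (pos_of_mul_pos_right this hk.le)
  have ha' : a ∈ Ioo 0 (Γ.length e) := ⟨ha, hlt.trans hb⟩
  have hb' : b ∈ Ioo 0 (Γ.length e) := ⟨ha.trans hlt, hb⟩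
  let s₀ : Γ.Segment f (Γ.openSegment e a b) :=
    { edge := e
      a := a
      b := b
      lt := hlt
      isCut_a := ⟨Ioo_subset_Icc_self ha', Or.inr (Or.inr hpa)⟩
      isCut_b := ⟨Ioo_subset_Icc_self hb', Or.inr (Or.inr hpb)⟩
      subset := fun x hx => ⟨x, hx, rfl⟩ }
  have huniq : ∀ s : Γ.Segment f (Γ.openSegment e a b), s = s₀ := by
    intro s
    have hx : (s.a + s.b) / 2 ∈ Ioo s.a s.b := ⟨by linarith [s.lt], by linarith [s.lt]⟩
    obtain ⟨y, hy, hyx⟩ := s.subset _ hx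
    obtain ⟨he, hxy⟩ := pt_eq_pt_of_mem_Ioo ⟨ha.trans hy.1, hy.2.trans hb⟩
      (Ioo_subset_Icc_self (s.mem_Ioo_length hx)) hyx
    exact Segment.eq_of_mem hC he hx (by rw [hxy]; exact hy)
  have hend : ∀ i, s₀.endVertex i = Sum.inr (s₀, i) := fun i =>
    Segment.endVertex_eq_inr (by cases i <;> assumption)
  let inst : Unique (Γ.Segment f (Γ.openSegment e a b)) := ⟨⟨s₀⟩, huniq⟩
  have hlen : ∀ s, k * (Γ.neumannDomainGraph f (Γ.openSegment e a b)).length s = Real.pi := by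
    intro s
    rw [huniq s]
    exact hab
  refine ⟨inferInstance, ⟨⟨⟨s₀.endVertex false, s₀, false, rfl⟩, fun _ => false, ?_, ?_, ?_, ?_⟩,
    ⟨s₀⟩, fun s => (hlen s).le, fun s => ?_, ?_, Or.inl Fintype.card_unique⟩⟩
  · intro s
    rw [huniq s]
    rfl
  · intro s
    rw [huniq s]
    intro h
    have h : s₀.endVertex true = s₀.endVertex false := congrArg Subtype.val h
    rw [hend, hend] at h
    simp at h
  · intro s s' _
    rw [huniq s, huniq s']
  · rintro ⟨w, s, i, rfl⟩
    rw [Subtype.mk.injEq, huniq s]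
    cases i
    · exact Or.inl rfl
    · exact Or.inr ⟨s₀, rfl⟩
  · rw [hlen, Real.cos_pi]
    norm_num
  · simp only [hlen, Real.tan_pi, Finset.sum_const_zero]

end openSegment

section starSet

variable {k : ℝ} {r : E → Bool → ℝ}

theorem mem_starSet_of_flip_lt (hr : ∀ e b, Γ.FirstExtremum f k e b (r e b)) {e : E} {b : Bool}
    {x : ℝ} (hx : x ∈ Icc 0 (Γ.length e)) (h : Γ.flip e b x < r e b) :
    Γ.pt e x ∈ Γ.starSet (· < ·) r (Γ.endpt e b) := by
  rw [pt_mem_starSet_iff (fun e b => (hr e b).pos) (fun e b => (hr e b).lt_length.not_gt) hx]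
  exact ⟨b, rfl, h⟩

theorem isCut_flip (hk : 0 < k) (hr : ∀ e b, Γ.FirstExtremum f k e b (r e b)) (e : E) (b : Bool) :
    Γ.IsCut f e (Γ.flip e b (r e b)) :=
  ⟨Ioo_subset_Icc_self (hr e b).mem_Ioo, Or.inr (Or.inr ((hr e b).mem_neumannPoints hk))⟩

/-- The segment between the end `b` of the edge `e` and the first Neumann point seen from there. -/
def endSegment (hk : 0 < k) (hr : ∀ e b, Γ.FirstExtremum f k e b (r e b)) (e : E) :
    (b : Bool) → Γ.Segment f (Γ.starSet (· < ·) r (Γ.endpt e b))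
  | false =>
    { edge := e
      a := 0
      b := r e false
      lt := (hr e false).pos
      isCut_a := isCut_endCoord e false
      isCut_b := isCut_flip hk hr e false
      subset := fun _ hx => mem_starSet_of_flip_lt hr (b := false)
        ⟨hx.1.le, (hx.2.trans (hr e false).lt_length).le⟩ hx.2 }
  | true =>
    { edge := e
      a := Γ.length e - r e true
      b := Γ.length e
      lt := sub_lt_self _ (hr e true).pos
      isCut_a := isCut_flip hk hr e true
      isCut_b := isCut_endCoord e true
      subset := fun _ hx => mem_starSet_of_flip_lt hr (b := true)
        ⟨(sub_pos.2 (hr e true).lt_length).le.trans hx.1.le, hx.2.le⟩ (sub_lt_comm.1 hx.1) }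

theorem endSegment_edge (hk : 0 < k) (hr : ∀ e b, Γ.FirstExtremum f k e b (r e b)) (e : E)
    (b : Bool) : (endSegment hk hr e b).edge = e := by
  cases b <;> rfl

theorem endSegment_coord (hk : 0 < k) (hr : ∀ e b, Γ.FirstExtremum f k e b (r e b)) (e : E)
    (b : Bool) : (endSegment hk hr e b).coord b = Γ.endCoord e b := by
  cases b <;> rfl

theorem endSegment_coord_not (hk : 0 < k) (hr : ∀ e b, Γ.FirstExtremum f k e b (r e b)) (e : E)
    (b : Bool) : (endSegment hk hr e b).coord (!b) = Γ.flip e b (r e b) := by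
  cases b <;> rfl

theorem endSegment_sub (hk : 0 < k) (hr : ∀ e b, Γ.FirstExtremum f k e b (r e b)) (e : E)
    (b : Bool) : (endSegment hk hr e b).b - (endSegment hk hr e b).a = r e b := by
  cases b <;> simp [endSegment]

theorem mem_endSegment_iff (hk : 0 < k) (hr : ∀ e b, Γ.FirstExtremum f k e b (r e b)) (e : E)
    (b : Bool) (x : ℝ) : x ∈ Ioo (endSegment hk hr e b).a (endSegment hk hr e b).b ↔
      Γ.flip e b x ∈ Ioo 0 (r e b) := by
  cases b
  · rfl
  · simp only [endSegment, mem_Ioo, flip_true]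
    constructor <;> rintro ⟨h1, h2⟩ <;> constructor <;> linarith

/-- The segment of the star around `v` at an edge end at `v`. -/
def starSegment (hk : 0 < k) (hr : ∀ e b, Γ.FirstExtremum f k e b (r e b)) (v : V)
    (h : {h : E × Bool // Γ.endpt h.1 h.2 = v}) : Γ.Segment f (Γ.starSet (· < ·) r v) :=
  h.2 ▸ endSegment hk hr h.1.1 h.1.2

theorem starSegment_edge (hk : 0 < k) (hr : ∀ e b, Γ.FirstExtremum f k e b (r e b)) (v : V)
    (h : {h : E × Bool // Γ.endpt h.1 h.2 = v}) : (starSegment hk hr v h).edge = h.1.1 := by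
  obtain ⟨⟨e, b⟩, rfl⟩ := h
  exact endSegment_edge hk hr e b

theorem starSegment_a (hk : 0 < k) (hr : ∀ e b, Γ.FirstExtremum f k e b (r e b)) (v : V)
    (h : {h : E × Bool // Γ.endpt h.1 h.2 = v}) :
    (starSegment hk hr v h).a = (endSegment hk hr h.1.1 h.1.2).a := by
  obtain ⟨⟨e, b⟩, rfl⟩ := h
  rfl

theorem starSegment_b (hk : 0 < k) (hr : ∀ e b, Γ.FirstExtremum f k e b (r e b)) (v : V)
    (h : {h : E × Bool // Γ.endpt h.1 h.2 = v}) :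
    (starSegment hk hr v h).b = (endSegment hk hr h.1.1 h.1.2).b := by
  obtain ⟨⟨e, b⟩, rfl⟩ := h
  rfl

/-- A loop yields two segments, told apart by their left coordinates 0 and length - r > 0.
Conversely, the midpoint of any segment lies within the radius of some end at `v`, and segments with
a common inner point coincide. -/
theorem starSegment_bijective (hk : 0 < k) (hr : ∀ e b, Γ.FirstExtremum f k e b (r e b)) (v : V)
    (hC : Γ.starSet (· < ·) r v ⊆ (Γ.neumannPoints f)ᶜ) :
    Function.Bijective (starSegment hk hr v) := by
  constructor
  · rintro h h' hh
    have hE := congrArg Segment.edge hh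
    have hA := congrArg Segment.a hh
    rw [starSegment_edge, starSegment_edge] at hE
    rw [starSegment_a, starSegment_a] at hA
    obtain ⟨⟨e, b⟩, hb⟩ := h
    obtain ⟨⟨e', b'⟩, hb'⟩ := h'
    obtain rfl : e = e' := hE
    have hne := sub_pos.2 (hr e true).lt_length
    cases b <;> cases b'
    · rfl
    · exact absurd hA hne.ne
    · exact absurd hA hne.ne'
    · rfl
  · intro s
    have hx : (s.a + s.b) / 2 ∈ Ioo s.a s.b := ⟨by linarith [s.lt], by linarith [s.lt]⟩
    have hmem := s.subset _ hx
    rw [pt_mem_starSet_iff (fun e b => (hr e b).pos) (fun e b => (hr e b).lt_length.not_gt)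
      (Ioo_subset_Icc_self (s.mem_Ioo_length hx))] at hmem
    obtain ⟨b, hv, hb⟩ := hmem
    refine ⟨⟨(s.edge, b), hv⟩, Segment.eq_of_mem hC (starSegment_edge hk hr v _) ?_ hx⟩
    rw [starSegment_a, starSegment_b, mem_endSegment_iff]
    exact ⟨(flip_mem_Ioo b (s.mem_Ioo_length hx)).1, hb⟩

/-- The Kirchhoff condition at `v` divided by k f(v). -/
theorem sum_tan_eq_zero [Finite E] (hk : 0 < k) (hr : ∀ e b, Γ.FirstExtremum f k e b (r e b))
    (hf : Γ.SolvesEigenEquation (k ^ 2) f) (v : V) (hv : f (Point.vertex v) ≠ 0)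
    [Fintype {h : E × Bool // Γ.endpt h.1 h.2 = v}] :
    ∑ h : {h : E × Bool // Γ.endpt h.1 h.2 = v}, Real.tan (k * r h.1.1 h.1.2) = 0 := by
  have h0 := (hasSum_fintype _).unique (hf.vertex_condition v)
  have hout : ∀ h : {h : E × Bool // Γ.endpt h.1 h.2 = v}, Γ.outDeriv f h.1.1 h.1.2 =
      k * f (Point.vertex v) * Real.tan (k * r h.1.1 h.1.2) := by
    rintro ⟨⟨e, b⟩, rfl⟩
    exact (hr e b).outDeriv_eq_mul_tan hv
  simp only [hout, ← Finset.mul_sum] at h0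
  have hk' : (k : ℂ) ≠ 0 := by exact_mod_cast hk.ne'
  rw [mul_eq_zero_iff_left (mul_ne_zero hk' hv)] at h0
  exact_mod_cast h0

theorem exists_isNeumannStar_starSet [Finite E] (hk : 0 < k)
    (hf : Γ.IsGenericEigenfunction (k ^ 2) f)
    (hr : ∀ e b, Γ.FirstExtremum f k e b (r e b)) (v : V) (hv : ∃ e b, Γ.endpt e b = v)
    (hC : Γ.starSet (· < ·) r v ⊆ (Γ.neumannPoints f)ᶜ) :
    ∃ _ : Fintype (Γ.Segment f (Γ.starSet (· < ·) r v)),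
      (Γ.neumannDomainGraph f (Γ.starSet (· < ·) r v)).IsNeumannStar k := by
  have hfin : Finite {h : E × Bool // Γ.endpt h.1 h.2 = v} := inferInstance
  have := Fintype.ofFinite {h : E × Bool // Γ.endpt h.1 h.2 = v}
  let φ := Equiv.ofBijective _ (starSegment_bijective hk hr v hC)
  have instF : Fintype (Γ.Segment f (Γ.starSet (· < ·) r v)) := Fintype.ofEquiv _ φ
  have hφ : ∀ s, ∃ h, φ h = s := φ.surjective
  have hcenter : ∀ h, (φ h).endVertex h.1.2 = Sum.inl v := by
    rintro ⟨⟨e, b⟩, rfl⟩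
    apply Segment.endVertex_eq_inl
    show Γ.pt (endSegment hk hr e b).edge ((endSegment hk hr e b).coord b) = _
    rw [endSegment_edge, endSegment_coord, pt_endCoord]
  have hleaf : ∀ h, (φ h).endVertex (!h.1.2) = Sum.inr (φ h, !h.1.2) := by
    rintro ⟨⟨e, b⟩, rfl⟩
    apply Segment.endVertex_eq_inr
    show (endSegment hk hr e b).coord (!b) ∈ Ioo 0 (Γ.length (endSegment hk hr e b).edge)
    rw [endSegment_edge, endSegment_coord_not]
    exact (hr e b).mem_Ioo
  have hlen : ∀ h, (Γ.neumannDomainGraph f (Γ.starSet (· < ·) r v)).length (φ h) =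
      r h.1.1 h.1.2 := by
    rintro ⟨⟨e, b⟩, rfl⟩
    exact endSegment_sub hk hr e b
  obtain ⟨e₀, b₀, hv₀⟩ := hv
  let h₀ : {h : E × Bool // Γ.endpt h.1 h.2 = v} := ⟨(e₀, b₀), hv₀⟩
  refine ⟨instF, ⟨⟨⟨Sum.inl v, φ h₀, b₀, hcenter h₀⟩, fun s => (φ.symm s).1.2, ?_, ?_, ?_, ?_⟩,
    ⟨φ h₀⟩, fun s => ?_, fun s => ?_, ?_, ?_⟩⟩
  · intro s
    obtain ⟨h, rfl⟩ := hφ s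
    simp only [Equiv.symm_apply_apply]
    exact Subtype.ext (hcenter h)
  · intro s hs
    obtain ⟨h, rfl⟩ := hφ s
    simp only [Equiv.symm_apply_apply] at hs
    have hs : (φ h).endVertex (!h.1.2) = Sum.inl v := congrArg Subtype.val hs
    rw [hleaf] at hs
    cases hs
  · intro s s' hs
    obtain ⟨h, rfl⟩ := hφ s
    obtain ⟨h', rfl⟩ := hφ s'
    simp only [Equiv.symm_apply_apply] at hs
    have hs : (φ h).endVertex (!h.1.2) = (φ h').endVertex (!h'.1.2) := congrArg Subtype.val hs
    rw [hleaf, hleaf] at hs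
    exact (Prod.ext_iff.1 (Sum.inr.inj hs)).1
  · rintro ⟨w, s, i, rfl⟩
    obtain ⟨h, rfl⟩ := hφ s
    by_cases hi : i = h.1.2
    · left
      rw [Subtype.mk.injEq, hi, hcenter]
    · right
      have hi : i = !h.1.2 := by cases i <;> cases hb : h.1.2 <;> simp_all
      refine ⟨φ h, ?_⟩
      simp only [Equiv.symm_apply_apply, hi]
      rfl
  · obtain ⟨h, rfl⟩ := hφ s
    rw [hlen]
    exact (hr _ _).le
  · obtain ⟨h, rfl⟩ := hφ s
    rw [hlen]
    exact (hr _ _).cos_ne_zero (hf.ne_zero_at_vertices _)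
  · rw [← φ.sum_comp]
    simp only [hlen]
    exact sum_tan_eq_zero hk hr hf.eigenfunction.1 v (hf.ne_zero_at_vertices v)
  -- Genericity keeps outgoing derivatives nonzero only at interior vertices. At a boundary vertex
  -- the star has a single arm, for which no strict bound is required.
  · by_cases hb : v ∈ Γ.boundary
    · left
      rw [← Nat.card_eq_fintype_card, ← Nat.card_congr φ]
      exact hb
    · right
      intro s
      obtain ⟨h, rfl⟩ := hφ s
      rw [hlen]
      exact (hr _ _).lt_pi (hf.outDeriv_ne_zero v hb _ _ h.2)

end starSet

theorem pi_lt_mul_length [Finite E] [Nonempty E] {k : ℝ} (hk : Real.pi / Γ.minLength < k) :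
    0 < k ∧ ∀ e, Real.pi < k * Γ.length e := by
  have hmin : 0 < Γ.minLength := by
    obtain ⟨e, he⟩ := exists_eq_ciInf_of_finite (f := Γ.length)
    rw [minLength, ← he]
    exact Γ.length_pos e
  have hk0 : 0 < k := (div_pos Real.pi_pos hmin).trans hk
  refine ⟨hk0, fun e => ((div_lt_iff₀ hmin).1 hk).trans_le ?_⟩
  exact mul_le_mul_of_nonneg_left (ciInf_le (finite_range _).bddBelow e) hk0.le

theorem IsNeumannDomain.exists_isNeumannStar (hΓ : Γ.IsStandard) {k : ℝ}
    (hk : Real.pi / Γ.minLength < k) (hf : Γ.IsGenericEigenfunction (k ^ 2) f)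
    (hC : Γ.IsNeumannDomain f C) :
    ∃ _ : Fintype (Γ.Segment f C), (Γ.neumannDomainGraph f C).IsNeumannStar k := by
  have := hΓ.finite_edges
  have := hΓ.nonempty_edges
  have := hΓ.connected
  obtain ⟨hk0, hlen⟩ := pi_lt_mul_length hk
  choose r hr using hf.exists_firstExtremum hk0 hlen
  have hsub := hC.subset
  rcases hC.eq_starSet_or_openSegment hk0 hr with
    ⟨v, rfl⟩ | ⟨e, a, b, hab, ha, hb, hpa, hpb, rfl⟩
  · exact exists_isNeumannStar_starSet hk0 hf hr v (exists_endpt_eq v) hsub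
  · exact exists_isNeumannStar_openSegment hk0 hab ha hb hpa hpb hsub

/-! ### Bounds on the spectral position and the wavelength capacity. -/

namespace IsNeumannStar

variable {V E : Type*} [Fintype E] {G : MetricGraph V E} {k : ℝ}

theorem wavelengthCapacity_mul_pi (G : MetricGraph V E) (k : ℝ) :
    G.wavelengthCapacity k * Real.pi = ∑ e, k * G.length e := by
  rw [wavelengthCapacity, totalLength, tsum_fintype, div_mul_cancel₀ _ Real.pi_pos.ne',
    Finset.sum_mul]
  simp only [mul_comm]

/-- A single angle in (0, π] with tangent zero and nonzero cosine equals π. The boundary has two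
points because the center is now also of degree one. -/
theorem values_of_card_eq_one (h : G.IsNeumannStar k) (hk : 0 < k)
    (hc : Fintype.card E = 1) :
    G.spectralPosition k = (1 : ℕ) ∧ G.boundary.encard = (2 : ℕ) ∧ G.wavelengthCapacity k = 1 := by
  classical
  obtain ⟨c, τ, hs⟩ := h.isStar
  have := h.nonempty
  obtain ⟨e, he⟩ := Fintype.card_eq_one_iff.1 hc
  let inst : Unique E := ⟨⟨e⟩, he⟩
  have hπ := Real.pi_pos
  have htan := h.sum_tan
  rw [Fintype.sum_unique] at htan
  obtain ⟨e', he'⟩ := exists_pi_div_two_lt (fun e => mul_pos hk (G.length_pos e)) h.sum_tan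
    h.cos_ne_zero
  have hlen : ∀ e, k * G.length e = Real.pi := by
    intro e
    rw [Subsingleton.elim e default]
    rw [Subsingleton.elim e' default] at he'
    by_contra hne
    have hlt := lt_of_le_of_ne (h.length_le default) hne
    rw [← Real.tan_sub_pi] at htan
    exact (Real.tan_neg_of_neg_of_pi_div_two_lt (by linarith) (by linarith)).ne htan
  refine ⟨?_, ?_, ?_⟩
  · rw [hs.spectralPosition_eq hk h.length_le h.cos_ne_zero h.sum_tan, Finset.filter_true_of_mem,
      Finset.card_univ, hc]
    intro e _
    rw [hlen]
    linarith
  · rw [hs.boundary_encard_of_card_eq_one hc]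
    rfl
  · have hw := wavelengthCapacity_mul_pi G k
    rw [Fintype.sum_unique, hlen] at hw
    exact mul_right_cancel₀ hπ.ne' (hw.trans (one_mul _).symm)

/-- With several arms, N counts the angles above π/2 and the boundary counts all of them. Both
classes are nonempty, by `exists_pi_div_two_lt` for the angles and for their reflections, and the
capacity is the sum of the angles divided by π. -/
theorem exists_bounds (h : G.IsNeumannStar k) (hk : 0 < k) :
    ∃ N B : ℕ, G.spectralPosition k = N ∧ G.boundary.encard = B ∧ 1 ≤ N ∧ N + 1 ≤ B ∧
      (1 / 2 : ℝ) * ((N : ℝ) + 1) ≤ G.wavelengthCapacity k ∧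
      G.wavelengthCapacity k ≤ (1 / 2 : ℝ) * ((N : ℝ) + (B : ℝ) - 1) := by
  classical
  by_cases hc : Fintype.card E = 1
  · obtain ⟨hN, hB, hρ⟩ := h.values_of_card_eq_one hk hc
    refine ⟨1, 2, hN, hB, le_rfl, le_rfl, ?_, ?_⟩ <;> rw [hρ] <;> norm_num
  · obtain ⟨c, τ, hs⟩ := h.isStar
    have := h.nonempty
    have hπ := Real.pi_pos
    have hlt := h.length_lt.resolve_left hc
    have h0 : ∀ e, 0 < k * G.length e := fun e => mul_pos hk (G.length_pos e)
    have hρ := wavelengthCapacity_mul_pi G k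
    refine ⟨_, _, hs.spectralPosition_eq hk h.length_le h.cos_ne_zero h.sum_tan,
      hs.boundary_encard hc, ?_, ?_, ?_, ?_⟩
    · obtain ⟨e, he⟩ := exists_pi_div_two_lt h0 h.sum_tan h.cos_ne_zero
      exact Finset.card_pos.2 ⟨e, by simpa using he⟩
    · rw [← card_filter_pi_div_two_lt_pi_sub h.cos_ne_zero, add_comm, add_le_add_iff_right]
      obtain ⟨e, he⟩ := exists_pi_div_two_lt (θ := fun e => Real.pi - k * G.length e)
        (fun e => sub_pos.2 (hlt e))
        (by simp only [Real.tan_pi_sub, Finset.sum_neg_distrib, h.sum_tan, neg_zero])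
        (fun e => by rw [Real.cos_pi_sub]; exact neg_ne_zero.2 (h.cos_ne_zero e))
      exact Finset.card_pos.2 ⟨e, by simpa using he⟩
    · have := pi_div_two_mul_card_add_one_le h0 hlt h.cos_ne_zero h.sum_tan
      rw [← hρ] at this
      refine le_of_mul_le_mul_right ?_ hπ
      linarith
    · have := sum_le_pi_div_two_mul h0 hlt h.cos_ne_zero h.sum_tan
      rw [← hρ] at this
      refine le_of_mul_le_mul_right ?_ hπ
      linarith

end IsNeumannStar

end MetricGraph

end

theorem proposition2p5 {V E : Type*} (Γ : MetricGraph V E) (hΓ : Γ.IsStandard)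
    (k : ℝ) (hk : Real.pi / Γ.minLength < k)
    (f : Γ.Point → ℂ) (hf : Γ.IsGenericEigenfunction (k ^ 2) f)
    (C : Set Γ.Point) (hC : Γ.IsNeumannDomain f C) :
    ∃ N B : ℕ,
      (Γ.neumannDomainGraph f C).spectralPosition k = N ∧
      (Γ.neumannDomainGraph f C).boundary.encard = B ∧
      1 ≤ N ∧
      (N : ℝ) ≤ (B : ℝ) - 1 ∧
      1 ≤ (1 / 2 : ℝ) * ((N : ℝ) + 1) ∧
      (1 / 2 : ℝ) * ((N : ℝ) + 1) ≤ (Γ.neumannDomainGraph f C).wavelengthCapacity k ∧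
      (Γ.neumannDomainGraph f C).wavelengthCapacity k ≤ (1 / 2 : ℝ) * ((N : ℝ) + (B : ℝ) - 1) ∧
      (1 / 2 : ℝ) * ((N : ℝ) + (B : ℝ) - 1) ≤ (B : ℝ) - 1 := by
  have := hΓ.finite_edges
  have := hΓ.nonempty_edges
  obtain ⟨_, hstar⟩ := hC.exists_isNeumannStar hΓ hk hf
  obtain ⟨N, B, hN, hB, h1, hNB, hlow, hupp⟩ := hstar.exists_bounds (Γ.pi_lt_mul_length hk).1
  have h1' : (1 : ℝ) ≤ N := by exact_mod_cast h1
  have hNB' : (N : ℝ) + 1 ≤ B := by exact_mod_cast hNB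
  exact ⟨N, B, hN, hB, h1, by linarith, by linarith, hlow, hupp, by linarith⟩
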